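/- Let $\mathcal C$ be a monoidal category. Suppose that $A, A^*$ are two-sided duals in $\mathcal C$: there are morphisms $\eta\colon I\to A^*\otimes A$, $\varepsilon\colon A\otimes A^*\to I$ making $A^*$ a left dual of $A$, and morphisms $\eta'\colon I\to A\otimes A^*$, $\varepsilon'\colon A^*\otimes A\to I$ making $A$ a left dual of $A^*$, each pair satisfying the snake equations. A *Frobenius 3-structure* consists of such $A,A^*$ and a morphism $\mu\colon A\otimes A^*\otimes A\to A$ satisfying (suppressing coherence isomorphisms) - associativity: $\mu\circ(\mathrm{id}_{A}\otimes\mathrm{id}_{A^*}\otimes\mu)=\mu\circ(\mu\otimes\mathrm{id}_{A^*}\otimes\mathrm{id}_A)$; - symmetry: $(\mu\otimes\mathrm{id}_{A^*\otimes A})\circ(\mathrm{id}_{A\otimes A^*}\otimes\eta'\otimes\mathrm{id}_A)\circ(\mathrm{id}_A\otimes\eta)=(\mathrm{id}_{A\otimes A^*}\otimes\mu)\circ(\mathrm{id}_A\otimes\eta\otimes\mathrm{id}_{A^*\otimes A})\circ(\eta'\otimes\mathrm{id}_A)$; this common morphism $\delta\colon A\to A\otimes A^*\otimes A$ is the comultiplication.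 Its left and right loops are $\ell=\mu\circ(\eta'\otimes\mathrm{id}_A)$ and $r=\mu\circ(\mathrm{id}_A\otimes\eta)$. The structure is *normal* if $\ell=r=\mathrm{id}_A$, and *sliding* if $\mu\circ(r\otimes\mathrm{id}_{A^*\otimes A})=r\circ\mu$ and $\mu\circ(\mathrm{id}_{A\otimes A^*}\otimes\ell)=\ell\circ\mu$. A *Frobenius 3-diagram* is a finite connected string diagram built from the pieces $\mu,\delta,\eta,\eta',\varepsilon,\varepsilon'$ using identities, composition and tensor products (connected: its underlying graph, whose nodes are the pieces and whose edges are the wires, is nonempty and connected). Its type is its pair of input and output tensor words in $A$ and $A^*$. It has *no internal loops* if its underlying graph contains no cycle. Two diagrams are *equal* if they denote the same morphism of $\mathcal C$. Then: 1. If the Frobenius 3-structure is sliding, any two Frobenius 3-diagrams of the same type that have no internal loops are equal. 2. If the Frobenius 3-structure is normal, any two Frobenius 3-diagrams of the same type for which the total number of inputs and outputs is greater than one are equal. -/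

import Mathlib

open CategoryTheory MonoidalCategory

universe v u

/-- A Frobenius 3-structure on an object `A` with two-sided dual `A'`. Two-sidedness is expressed by
two exact pairings: `ExactPairing A' A` gives `η_ A' A : 𝟙_ ⟶ A' ⊗ A` and `ε_ A' A : A ⊗ A' ⟶ 𝟙_`,
and `ExactPairing A A'` gives `η_ A A' : 𝟙_ ⟶ A ⊗ A'` and `ε_ A A' : A' ⊗ A ⟶ 𝟙_`. No
compatibility between the two pairings is assumed. -/
structure FrobeniusThreeStructure {C : Type u} [Category.{v} C] [MonoidalCategory C] (A A' : C)
    [ExactPairing A' A] [ExactPairing A A'] where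
  /-- The ternary multiplication. -/
  mul : A ⊗ A' ⊗ A ⟶ A
  /-- Associativity, as an equation of maps from `A ⊗ A' ⊗ A ⊗ A' ⊗ A` to `A`. -/
  assoc : A ◁ A' ◁ mul ≫ mul = 𝟙 (A ⊗ A' ⊗ A ⊗ A' ⊗ A) ⊗≫ mul ▷ (A' ⊗ A) ≫ mul
  /-- Symmetry: bending the two last inputs of `mul` around the right-hand side into outputs gives
  the same map as bending the two first inputs around the left-hand side. -/
  symm : 𝟙 A ⊗≫ A ◁ η_ A' A ⊗≫ (A ⊗ A') ◁ η_ A A' ▷ A ⊗≫ mul ▷ (A' ⊗ A) ⊗≫ 𝟙 (A ⊗ A' ⊗ A) =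
    𝟙 A ⊗≫ η_ A A' ▷ A ⊗≫ A ◁ η_ A' A ▷ (A' ⊗ A) ⊗≫ (A ⊗ A') ◁ mul ⊗≫ 𝟙 (A ⊗ A' ⊗ A)

namespace FrobeniusThreeStructure

variable {C : Type u} [Category.{v} C] [MonoidalCategory C] {A A' : C}
  [ExactPairing A' A] [ExactPairing A A'] (F : FrobeniusThreeStructure A A')

/-- The comultiplication: the common value of the two sides of the symmetry equation. -/
def comul : A ⟶ A ⊗ A' ⊗ A :=
  𝟙 A ⊗≫ A ◁ η_ A' A ⊗≫ (A ⊗ A') ◁ η_ A A' ▷ A ⊗≫ F.mul ▷ (A' ⊗ A) ⊗≫ 𝟙 (A ⊗ A' ⊗ A)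

/-- The left loop: the two first inputs of the multiplication are joined by a cup. -/
def leftLoop : A ⟶ A :=
  𝟙 A ⊗≫ η_ A A' ▷ A ⊗≫ F.mul

/-- The right loop: the two last inputs of the multiplication are joined by a cup. -/
def rightLoop : A ⟶ A :=
  𝟙 A ⊗≫ A ◁ η_ A' A ⊗≫ F.mul

/-- A Frobenius 3-structure is normal when both its loops are identities. -/
def Normal : Prop :=
  F.leftLoop = 𝟙 A ∧ F.rightLoop = 𝟙 A

/-- Sliding: a right loop on the first input, or a left loop on the last input, of the
multiplication can be moved to its output. -/
def Sliding : Prop :=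
  F.rightLoop ▷ (A' ⊗ A) ≫ F.mul = F.mul ≫ F.rightLoop ∧
    A ◁ A' ◁ F.leftLoop ≫ F.mul = F.mul ≫ F.leftLoop

end FrobeniusThreeStructure

namespace FrobeniusThree

/-- The two kinds of wires: `up` stands for `A`, `down` for its dual `A'`. -/
inductive Wire : Type
  | up : Wire
  | down : Wire

/-- Types of inputs and outputs: bracketed tensor words in the two kinds of wires. -/
abbrev Word : Type := FreeMonoidalCategory Wire

namespace Word

/-- The word `A`. -/
abbrev up : Word := FreeMonoidalCategory.of Wire.up

/-- The word `A'`. -/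
abbrev down : Word := FreeMonoidalCategory.of Wire.down

/-- The empty word, standing for the monoidal unit. -/
abbrev one : Word := FreeMonoidalCategory.unit

/-- The word `A ⊗ A' ⊗ A`. -/
abbrev three : Word := up.tensor (down.tensor up)

/-- The number of wires of a word. -/
def numWires : Word → ℕ
  | FreeMonoidalCategory.of _ => 1
  | FreeMonoidalCategory.unit => 0
  | FreeMonoidalCategory.tensor X Y => numWires X + numWires Y

/-- The individual wires of a word. -/
def Port : Word → Type
  | FreeMonoidalCategory.of _ => Unit
  | FreeMonoidalCategory.unit => Empty
  | FreeMonoidalCategory.tensor X Y => Port X ⊕ Port Y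

end Word

/-- Diagrams (not necessarily connected) built from the six pieces multiplication,
comultiplication, the two cups and the two caps, by identities, composition and tensor products.
Since words are bracketed, associators and unitors, which are drawn as identities, are included. -/
inductive Diagram : Word → Word → Type
  | mul : Diagram Word.three Word.up
  | comul : Diagram Word.up Word.three
  | cup : Diagram Word.one (Word.down.tensor Word.up)
  | cupSwap : Diagram Word.one (Word.up.tensor Word.down)
  | cap : Diagram (Word.up.tensor Word.down) Word.one
  | capSwap : Diagram (Word.down.tensor Word.up) Word.one
  | id (X : Word) : Diagram X X
  | assocHom (X Y Z : Word) : Diagram ((X.tensor Y).tensor Z) (X.tensor (Y.tensor Z))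
  | assocInv (X Y Z : Word) : Diagram (X.tensor (Y.tensor Z)) ((X.tensor Y).tensor Z)
  | leftUnitorHom (X : Word) : Diagram (Word.one.tensor X) X
  | leftUnitorInv (X : Word) : Diagram X (Word.one.tensor X)
  | rightUnitorHom (X : Word) : Diagram (X.tensor Word.one) X
  | rightUnitorInv (X : Word) : Diagram X (X.tensor Word.one)
  | comp {X Y Z : Word} (D : Diagram X Y) (E : Diagram Y Z) : Diagram X Z
  | tensor {X Y Z W : Word} (D : Diagram X Y) (E : Diagram Z W) :
      Diagram (X.tensor Z) (Y.tensor W)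

/-- A graph with, for each wire of `X` and of `Y`, a node at which this wire is attached. -/
structure PortGraph (X Y : Word) where
  Node : Type
  graph : SimpleGraph Node
  input : Word.Port X → Node
  output : Word.Port Y → Node

namespace PortGraph

/-- A single node to which all wires are attached. -/
def dot (X Y : Word) : PortGraph X Y where
  Node := Unit
  graph := ⊥
  input := fun _ => ()
  output := fun _ => ()

/-- Parallel wires, one node for each. -/
def wires {X Y : Word} (e : Word.Port X ≃ Word.Port Y) : PortGraph X Y where
  Node := Word.Port Y
  graph := ⊥
  input := e
  output := fun p => p

/-- Juxtaposition: the disjoint union of the two graphs. -/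
def tensor {X Y Z W : Word} (G : PortGraph X Y) (H : PortGraph Z W) :
    PortGraph (X.tensor Z) (Y.tensor W) where
  Node := G.Node ⊕ H.Node
  graph := G.graph ⊕g H.graph
  input := Sum.map G.input H.input
  output := Sum.map G.output H.output

/-- Gluing: for each wire `p` of the common boundary there is one new node, joined by one edge to
the node of `G` and by one edge to the node of `H` at which `p` is attached. Because of the new
nodes, two wires between the same two nodes form a cycle of this simple graph. -/
def comp {X Y Z : Word} (G : PortGraph X Y) (H : PortGraph Y Z) : PortGraph X Z where
  Node := G.Node ⊕ (Word.Port Y ⊕ H.Node)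
  graph := (G.graph ⊕g (⊥ ⊕g H.graph)) ⊔
    SimpleGraph.fromRel fun a b => ∃ p : Word.Port Y, a = Sum.inr (Sum.inl p) ∧
      (b = Sum.inl (G.output p) ∨ b = Sum.inr (Sum.inr (H.input p)))
  input := fun p => Sum.inl (G.input p)
  output := fun p => Sum.inr (Sum.inr (H.output p))

end PortGraph

namespace Diagram

/-- The underlying graph of a diagram. -/
def toGraph : {X Y : Word} → Diagram X Y → PortGraph X Y
  | _, _, mul => PortGraph.dot _ _
  | _, _, comul => PortGraph.dot _ _
  | _, _, cup => PortGraph.dot _ _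
  | _, _, cupSwap => PortGraph.dot _ _
  | _, _, cap => PortGraph.dot _ _
  | _, _, capSwap => PortGraph.dot _ _
  | _, _, id X => PortGraph.wires (Equiv.refl (Word.Port X))
  | _, _, assocHom X Y Z =>
      PortGraph.wires (Equiv.sumAssoc (Word.Port X) (Word.Port Y) (Word.Port Z))
  | _, _, assocInv X Y Z =>
      PortGraph.wires (Equiv.sumAssoc (Word.Port X) (Word.Port Y) (Word.Port Z)).symm
  | _, _, leftUnitorHom X => PortGraph.wires (Equiv.emptySum Empty (Word.Port X))
  | _, _, leftUnitorInv X => PortGraph.wires (Equiv.emptySum Empty (Word.Port X)).symm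
  | _, _, rightUnitorHom X => PortGraph.wires (Equiv.sumEmpty (Word.Port X) Empty)
  | _, _, rightUnitorInv X => PortGraph.wires (Equiv.sumEmpty (Word.Port X) Empty).symm
  | _, _, comp D E => D.toGraph.comp E.toGraph
  | _, _, tensor D E => D.toGraph.tensor E.toGraph

/-- A diagram is connected when its underlying graph is (in particular it is not empty). The
Frobenius 3-diagrams are the connected diagrams. -/
def Connected {X Y : Word} (D : Diagram X Y) : Prop :=
  D.toGraph.graph.Connected

/-- A diagram has no internal loops when its underlying graph contains no cycle. -/
def NoInternalLoops {X Y : Word} (D : Diagram X Y) : Prop :=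
  D.toGraph.graph.IsAcyclic

end Diagram

end FrobeniusThree

namespace FrobeniusThreeStructure

open FrobeniusThree

/-- The object for which a kind of wire stands. -/
def wireObj {C : Type u} (A A' : C) : Wire → C
  | Wire.up => A
  | Wire.down => A'

/-- The object for which a word stands. -/
abbrev wordObj {C : Type u} [Category.{v} C] [MonoidalCategory C] (A A' : C) (X : Word) : C :=
  FreeMonoidalCategory.projectObj (wireObj A A') X

variable {C : Type u} [Category.{v} C] [MonoidalCategory C] {A A' : C}
  [ExactPairing A' A] [ExactPairing A A']

/-- The morphism that a diagram denotes in a given Frobenius 3-structure. -/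
def eval (F : FrobeniusThreeStructure A A') :
    {X Y : Word} → Diagram X Y → (wordObj A A' X ⟶ wordObj A A' Y)
  | _, _, Diagram.mul => F.mul
  | _, _, Diagram.comul => F.comul
  | _, _, Diagram.cup => η_ A' A
  | _, _, Diagram.cupSwap => η_ A A'
  | _, _, Diagram.cap => ε_ A' A
  | _, _, Diagram.capSwap => ε_ A A'
  | _, _, Diagram.id X => 𝟙 (wordObj A A' X)
  | _, _, Diagram.assocHom X Y Z => (α_ (wordObj A A' X) (wordObj A A' Y) (wordObj A A' Z)).hom
  | _, _, Diagram.assocInv X Y Z => (α_ (wordObj A A' X) (wordObj A A' Y) (wordObj A A' Z)).inv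
  | _, _, Diagram.leftUnitorHom X => (λ_ (wordObj A A' X)).hom
  | _, _, Diagram.leftUnitorInv X => (λ_ (wordObj A A' X)).inv
  | _, _, Diagram.rightUnitorHom X => (ρ_ (wordObj A A' X)).hom
  | _, _, Diagram.rightUnitorInv X => (ρ_ (wordObj A A' X)).inv
  | _, _, Diagram.comp D E => F.eval D ≫ F.eval E
  | _, _, Diagram.tensor D E => F.eval D ⊗ₘ F.eval E

end FrobeniusThreeStructure

/-!
Every diagram is brought to a normal form that depends only on its type.

*Operators.* Diagrams are applied to lists of wires, read as tensor products bracketed to the right.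
`Op` is the monoid of partial operations on such lists, and `Op.sh i O` applies `O` after the first
`i` wires. Since an operator remembers no type, equations between string diagrams become equations
in a monoid, without coherence isomorphisms. `Diagram.toOp` turns a diagram into an operator, and
`Diagram.exists_toOp_app` recovers its value in the category.

*Normal form.* By `Op.comulDown`, the comultiplication of `A` has a counterpart for `A'`; together
they form `Op.fork`, which replaces a wire `x` by three wires `x`, `x.dual`, `x`. Associativity and
symmetry imply that forks after a cup can be moved to the first wire, so that an iterated
comultiplication of a cup, the block `blk F x m`, depends only on the number of its forks
(`blk_fork`). A cap that joins two blocks yields a block, and in a normal structure so does a cap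
that joins two wires of one block (`blk_cap`). Hence a planar arrangement of blocks (`Planar`)
remains one when a fork or a cap is applied (`Planar.fork`, `Planar.cap`). As the multiplication is
a fork followed by two caps (`Op.mul_eq_fork`), every diagram sends planar arrangements to planar
arrangements (`Diagram.transforms`).

*Which equality holds.* Capping two wires of one block needs normality, and it closes a loop. The
number of times it happens is determined by the number of blocks and the Euler characteristic of the
diagram, which is one for a tree (`PortGraph.HasEuler.eq_one`); for a connected diagram without
loops it never happens.

*Conclusion.* The inputs of a connected diagram are bent to the left by `Op.coev`, which is a planar
arrangement of cups. The result is a planar arrangement, and colourings of its wires that are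
constant on blocks extend to the diagram, so connectedness leaves a single block
(`Diagram.exists_planar`). A single block is determined by its word (`Planar.unique`), and bending
is invertible (`Op.gdWord_mul_eq`). The only obstruction is a block without any outer wires. It is
excluded in a normal structure by the assumption on the number of wires, and for a tree by an Euler
characteristic count (`Diagram.two_mul_chi_le`).
-/

namespace FrobeniusThree

/-! ### Operators on words of wires -/

/-- The other kind of wire. -/
def Wire.dual : Wire → Wire
  | Wire.up => Wire.down
  | Wire.down => Wire.up

@[simp] theorem Wire.dual_dual (x : Wire) : x.dual.dual = x := by cases x <;> rfl

section Ops

open FrobeniusThreeStructure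

variable {C : Type u} [Category.{v} C] [MonoidalCategory C]

/-- The object for which a list of wires stands: the tensor product bracketed to the right. -/
def listObj (A A' : C) : List Wire → C
  | [] => 𝟙_ C
  | x :: w => wireObj A A' x ⊗ listObj A A' w

/-- Operators send some words `w` to a word `w'` together with a morphism from the object of `w` to
the object of `w'`, and are undefined on the other words. A word is transformed from its head, so
that whatever comes after the wires on which a local operator acts is left alone. Because operators
are (partial) functions of the word, equations between them need no transport along equalities of
words. -/
@[ext]
structure Op (A A' : C) : Type v where
  /-- The value of an operator on a word. -/
  app : ∀ w : List Wire, Option (Σ w' : List Wire, (listObj A A' w ⟶ listObj A A' w'))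

variable {A A' : C}

namespace Op

instance : One (Op A A') := ⟨⟨fun w => some ⟨w, 𝟙 _⟩⟩⟩

/-- Operators are composed in diagrammatic order. -/
instance : Mul (Op A A') :=
  ⟨fun O P => ⟨fun w => (O.app w).bind fun f => (P.app f.1).map fun g => ⟨g.1, f.2 ≫ g.2⟩⟩⟩

@[simp] theorem one_app (w : List Wire) : (1 : Op A A').app w = some ⟨w, 𝟙 _⟩ := rfl

@[simp] theorem mul_app (O P : Op A A') (w : List Wire) :
    (O * P).app w = (O.app w).bind fun f => (P.app f.1).map fun g => ⟨g.1, f.2 ≫ g.2⟩ := rfl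

instance : Monoid (Op A A') where
  one_mul O := by
    ext1; funext w
    cases h : O.app w <;> simp [h]
  mul_one O := by
    ext1; funext w
    cases h : O.app w <;> simp [h]
  mul_assoc O P Q := by
    ext1; funext w
    rcases h : O.app w with _ | ⟨w₁, f⟩
    · simp [h]
    rcases h₁ : P.app w₁ with _ | ⟨w₂, g⟩
    · simp [h, h₁]
    rcases h₂ : Q.app w₂ with _ | ⟨w₃, k⟩ <;> simp [h, h₁, h₂]

/-- The operator `O` applied after the first wire. On the empty word it is the identity, which
makes this a monoid homomorphism. -/
def shift : Op A A' →* Op A A' where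
  toFun O := ⟨fun w => match w with
    | [] => some ⟨[], 𝟙 _⟩
    | x :: w => (O.app w).map fun g => ⟨x :: g.1, wireObj A A' x ◁ g.2⟩⟩
  map_one' := by
    ext1; funext w
    cases w <;> simp [listObj]
  map_mul' O P := by
    ext1; funext w
    rcases w with _ | ⟨x, w⟩
    · simp
    rcases h₁ : O.app w with _ | ⟨w₁, f⟩
    · simp [h₁]
    rcases h₂ : P.app w₁ with _ | ⟨w₂, g⟩ <;> simp [h₁, h₂]
    rfl

@[simp] theorem shift_nil (O : Op A A') : (shift O).app [] = some ⟨[], 𝟙 _⟩ := rfl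

@[simp] theorem shift_cons (O : Op A A') (x : Wire) (w : List Wire) :
    (shift O).app (x :: w) = (O.app w).map fun g => ⟨x :: g.1, wireObj A A' x ◁ g.2⟩ := rfl

/-- The operator `O` applied after the first `n` wires. -/
def sh : ℕ → Op A A' →* Op A A'
  | 0 => MonoidHom.id _
  | n + 1 => shift.comp (sh n)

@[simp] theorem sh_zero (O : Op A A') : sh 0 O = O := rfl

theorem sh_succ (n : ℕ) (O : Op A A') : sh (n + 1) O = shift (sh n O) := rfl

theorem sh_sh (m n : ℕ) (O : Op A A') : sh m (sh n O) = sh (m + n) O := by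
  induction m with
  | zero => simp
  | succ m ih => rw [Nat.succ_add, sh_succ, sh_succ, ih]

/-- If `O` removes `a` wires and inserts `b` wires at the head of a word, then `O` can be exchanged
with any operator that acts behind these wires. -/
theorem sh_comm {O : Op A A'} {a b : ℕ} (h : ∀ Q, O * sh b Q = sh a Q * O) (Q : Op A A') {i j k : ℕ}
    (hj : i + b ≤ j) (hk : k + b = j + a) : sh i O * sh j Q = sh k Q * sh i O := by
  obtain ⟨l, rfl⟩ := Nat.exists_eq_add_of_le hj
  obtain rfl : k = i + (a + l) := by omega
  rw [Nat.add_assoc, ← sh_sh i (b + l), ← sh_sh b, ← map_mul, h, map_mul, sh_sh, sh_sh,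
    Nat.add_assoc]

/-! ### The local operators -/

section Pairing

variable (X Y : C) [ExactPairing X Y]

/-- Insertion of a cup in front of `V`. -/
def cupAt (V : C) : V ⟶ X ⊗ (Y ⊗ V) := (λ_ V).inv ≫ η_ X Y ▷ V ≫ (α_ X Y V).hom

/-- A cap in front of `V`. -/
def capAt (V : C) : Y ⊗ (X ⊗ V) ⟶ V := (α_ Y X V).inv ≫ ε_ X Y ▷ V ≫ (λ_ V).hom

theorem cupAt_naturality {V W : C} (f : V ⟶ W) :
    cupAt X Y V ≫ X ◁ Y ◁ f = f ≫ cupAt X Y W := by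
  rw [cupAt, cupAt, Category.assoc, Category.assoc, ← associator_naturality_right,
    ← whisker_exchange_assoc, leftUnitor_inv_naturality_assoc]

theorem capAt_naturality {V W : C} (f : V ⟶ W) :
    capAt X Y V ≫ f = Y ◁ X ◁ f ≫ capAt X Y W := by
  rw [capAt, capAt, Category.assoc, Category.assoc, ← leftUnitor_naturality,
    ← whisker_exchange_assoc, associator_inv_naturality_right_assoc]

theorem cupAt_capAt (V : C) : cupAt X Y (X ⊗ V) ≫ X ◁ capAt X Y V = 𝟙 _ := by
  have h := ExactPairing.evaluation_coevaluation X Y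
  calc _ = 𝟙 _ ⊗≫ (η_ X Y ▷ X ⊗≫ X ◁ ε_ X Y) ▷ V ⊗≫ 𝟙 _ := by
        simp only [cupAt, capAt]; monoidal
    _ = 𝟙 _ ⊗≫ ((λ_ X).hom ≫ (ρ_ X).inv) ▷ V ⊗≫ 𝟙 _ := by
        rw [← h]; monoidal
    _ = _ := by monoidal

theorem cupAt_capAt' (V : C) : Y ◁ cupAt X Y V ≫ capAt X Y (Y ⊗ V) = 𝟙 _ := by
  have h := ExactPairing.coevaluation_evaluation X Y
  calc _ = 𝟙 _ ⊗≫ (Y ◁ η_ X Y ⊗≫ ε_ X Y ▷ Y) ▷ V ⊗≫ 𝟙 _ := by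
        simp only [cupAt, capAt]; monoidal
    _ = 𝟙 _ ⊗≫ ((ρ_ Y).hom ≫ (λ_ Y).inv) ▷ V ⊗≫ 𝟙 _ := by
        rw [← h]; monoidal
    _ = _ := by monoidal

end Pairing

/-- The identity of the words that begin with `x`. -/
def gd (x : Wire) : Op A A' where
  app w := match x, w with
    | Wire.up, Wire.up :: w => some ⟨Wire.up :: w, 𝟙 _⟩
    | Wire.down, Wire.down :: w => some ⟨Wire.down :: w, 𝟙 _⟩
    | _, _ => none

@[simp] theorem gd_nil (x : Wire) : (gd (A := A) (A' := A') x).app [] = none := by cases x <;> rfl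

@[simp] theorem gd_cons (x : Wire) (w : List Wire) :
    (gd (A := A) (A' := A') x).app (x :: w) = some ⟨x :: w, 𝟙 _⟩ := by cases x <;> rfl

theorem gd_mul_ext {x : Wire} {O P : Op A A'} (h : ∀ w, O.app (x :: w) = P.app (x :: w)) :
    gd x * O = gd x * P := by
  ext1; funext w
  rcases w with _ | ⟨y, w⟩
  · simp
  cases x <;> cases y <;> simp [gd, h]

theorem gd_comm_base (x : Wire) (Q : Op A A') : gd x * sh 1 Q = sh 1 Q * gd x := by
  ext1; funext w
  rcases w with _ | ⟨y, w⟩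
  · cases x <;> rfl
  rcases h : Q.app w with _ | ⟨w', f⟩ <;> cases x <;> cases y <;> simp [sh, h, gd, listObj]

variable [ExactPairing A' A] [ExactPairing A A']

/-- Insertion of a cup whose first wire is `x`. -/
def cup (x : Wire) : Op A A' where
  app w := match x with
    | Wire.up => some ⟨Wire.up :: Wire.down :: w, cupAt A A' (listObj A A' w)⟩
    | Wire.down => some ⟨Wire.down :: Wire.up :: w, cupAt A' A (listObj A A' w)⟩

/-- A cap that joins the first two wires; these must be of different kinds. -/
def cap : Op A A' where
  app w := match w with
    | Wire.up :: Wire.down :: w => some ⟨w, capAt A' A (listObj A A' w)⟩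
    | Wire.down :: Wire.up :: w => some ⟨w, capAt A A' (listObj A A' w)⟩
    | _ => none

theorem cup_comm_base (x : Wire) (Q : Op A A') : cup x * sh 2 Q = sh 0 Q * cup x := by
  ext1; funext w
  rcases h : Q.app w with _ | ⟨w', f⟩
  · cases x <;> simp [sh, h, cup]
  · cases x
    · simp [sh, h, cup]; exact cupAt_naturality A A' f
    · simp [sh, h, cup]; exact cupAt_naturality A' A f

theorem cap_comm_base (Q : Op A A') : cap * sh 0 Q = sh 2 Q * cap := by
  ext1; funext w
  rcases w with _ | ⟨x, _ | ⟨y, w⟩⟩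
  · rfl
  · cases x <;> rfl
  rcases h : Q.app w with _ | ⟨w', f⟩
  · cases x <;> cases y <;> simp [sh, h, cap]
  · cases x <;> cases y
    · simp [sh, h, cap]
    · simp [sh, h, cap]; exact capAt_naturality A' A f
    · simp [sh, h, cap]; exact capAt_naturality A A' f
    · simp [sh, h, cap]

/-- The first snake equation. -/
theorem cup_cap (x : Wire) : gd x * (cup x * sh 1 cap) = gd (A := A) (A' := A') x := by
  rw [← mul_one (gd x), mul_assoc, one_mul]
  refine gd_mul_ext fun w => ?_
  cases x
  · simp [sh, cup, cap]; exact cupAt_capAt A A' (listObj A A' w)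
  · simp [sh, cup, cap]; exact cupAt_capAt A' A (listObj A A' w)

/-- The second snake equation. -/
theorem cup_cap' (x : Wire) : gd x * (sh 1 (cup x.dual) * cap) = gd (A := A) (A' := A') x := by
  rw [← mul_one (gd x), mul_assoc, one_mul]
  refine gd_mul_ext fun w => ?_
  cases x
  · simp [sh, cup, cap, Wire.dual]; exact cupAt_capAt' A' A (listObj A A' w)
  · simp [sh, cup, cap, Wire.dual]; exact cupAt_capAt' A A' (listObj A A' w)

theorem cup_gd (x : Wire) : cup x * gd x = cup (A := A) (A' := A') x := by
  ext1; funext w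
  cases x <;> simp [cup, listObj, wireObj]

theorem cup_gd' (x : Wire) : cup x * sh 1 (gd x.dual) = cup (A := A) (A' := A') x := by
  ext1; funext w
  cases x <;> simp [cup, sh, Wire.dual, listObj, wireObj]

end Op

end Ops

end FrobeniusThree

namespace FrobeniusThree

open FrobeniusThreeStructure

variable {C : Type u} [Category.{v} C] [MonoidalCategory C] {A A' : C}

namespace Op

/-! ### The multiplication as an operator -/

theorem ext_gd {O P : Op A A'} (h₀ : O.app [] = P.app []) (h : ∀ x, gd x * O = gd x * P) :
    O = P := by
  ext1; funext w
  rcases w with _ | ⟨x, w⟩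
  · exact h₀
  have h' (Q : Op A A') : (gd x * Q).app (x :: w) = Q.app (x :: w) := by
    cases h : Q.app (x :: w) <;> simp [h]
  rw [← h' O, h x, h' P]

/-- The operator `O` replaces the word `s` at the head of a word by the word `t`. -/
def Maps (O : Op A A') (s t : List Wire) : Prop :=
  ∀ w, ∃ f, O.app (s ++ w) = some ⟨t ++ w, f⟩

theorem Maps.mul {O P : Op A A'} {s t r : List Wire} (hO : O.Maps s t) (hP : P.Maps t r) :
    (O * P).Maps s r := by
  intro w
  obtain ⟨f, hf⟩ := hO w
  obtain ⟨g, hg⟩ := hP w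
  exact ⟨f ≫ g, by simp [hf, hg]⟩

theorem Maps.sh {O : Op A A'} {s t : List Wire} (h : O.Maps s t) (u r : List Wire) :
    (sh u.length O).Maps (u ++ (s ++ r)) (u ++ (t ++ r)) := by
  intro w
  induction u with
  | nil =>
    obtain ⟨f, hf⟩ := h (r ++ w)
    rw [List.nil_append, List.nil_append, List.append_assoc, List.append_assoc]
    exact ⟨f, hf⟩
  | cons x u ih =>
    obtain ⟨f, hf⟩ := ih
    exact ⟨wireObj A A' x ◁ f, by simp only [List.cons_append, List.length_cons, sh_succ,
      shift_cons, hf, Option.map_some]⟩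

theorem sh_gd_app (u : List Wire) (x : Wire) (w : List Wire) :
    (sh u.length (gd x)).app (u ++ x :: w) = some ⟨u ++ x :: w, 𝟙 (listObj A A' _)⟩ := by
  induction u with
  | nil => simp
  | cons y u ih => simp [sh_succ, ih, listObj]

theorem Maps.mul_gd {O : Op A A'} {u r : List Wire} {x : Wire} (h : O.Maps [] (u ++ x :: r)) :
    O * Op.sh u.length (gd x) = O := by
  ext1; funext w
  obtain ⟨f, hf⟩ := h w
  change O.app w = _ at hf
  have h' := sh_gd_app (A := A) (A' := A') u x (r ++ w)
  rw [← List.cons_append, ← List.append_assoc] at h'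
  simp [hf, h']

theorem Maps.gd_mul_gd {O : Op A A'} {u r : List Wire} {x y : Wire}
    (h : O.Maps [y] (u ++ x :: r)) : gd y * (O * Op.sh u.length (gd x)) = gd y * O := by
  refine gd_mul_ext fun w => ?_
  obtain ⟨f, hf⟩ := h w
  change O.app (y :: w) = _ at hf
  have h' := sh_gd_app (A := A) (A' := A') u x (r ++ w)
  rw [← List.cons_append, ← List.append_assoc] at h'
  simp [hf, h']

variable [ExactPairing A' A] [ExactPairing A A'] (F : FrobeniusThreeStructure A A')

/-- The multiplication in front of `V`. -/
def mulAt (V : C) : A ⊗ (A' ⊗ (A ⊗ V)) ⟶ A ⊗ V :=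
  A ◁ (α_ A' A V).inv ≫ (α_ A (A' ⊗ A) V).inv ≫ F.mul ▷ V

theorem mulAt_naturality {V W : C} (f : V ⟶ W) :
    mulAt F V ≫ A ◁ f = A ◁ A' ◁ A ◁ f ≫ mulAt F W := by
  simp only [mulAt, Category.assoc]
  rw [← whisker_exchange, ← associator_inv_naturality_right_assoc, ← whiskerLeft_comp_assoc,
    ← associator_inv_naturality_right, whiskerLeft_comp_assoc]

theorem mulAt_assoc (V : C) :
    A ◁ A' ◁ mulAt F V ≫ mulAt F V = mulAt F (A' ⊗ (A ⊗ V)) ≫ mulAt F V := by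
  calc _ = 𝟙 _ ⊗≫ (A ◁ A' ◁ F.mul ≫ F.mul) ▷ V ⊗≫ 𝟙 _ := by simp only [mulAt]; monoidal
    _ = _ := by rw [F.assoc]; simp only [mulAt]; monoidal

theorem mulAt_symm (V : C) :
    A ◁ cupAt A' A V ≫ A ◁ A' ◁ cupAt A A' (A ⊗ V) ≫ mulAt F (A' ⊗ (A ⊗ V)) =
      cupAt A A' (A ⊗ V) ≫ A ◁ cupAt A' A (A' ⊗ (A ⊗ V)) ≫ A ◁ A' ◁ mulAt F V := by
  calc _ = 𝟙 _ ⊗≫ (𝟙 A ⊗≫ A ◁ η_ A' A ⊗≫ (A ⊗ A') ◁ η_ A A' ▷ A ⊗≫ F.mul ▷ (A' ⊗ A) ⊗≫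
          𝟙 (A ⊗ A' ⊗ A)) ▷ V ⊗≫ 𝟙 _ := by
        simp only [mulAt, cupAt]; monoidal
    _ = _ := by rw [F.symm]; simp only [mulAt, cupAt]; monoidal

theorem cupAt_mulAt (hF : F.Normal) (V : C) : cupAt A A' (A ⊗ V) ≫ mulAt F V = 𝟙 (A ⊗ V) := by
  rw [← id_whiskerRight, ← hF.1]
  simp only [mulAt, cupAt, leftLoop]; monoidal

theorem cupAt_mulAt' (hF : F.Normal) (V : C) : A ◁ cupAt A' A V ≫ mulAt F V = 𝟙 (A ⊗ V) := by
  rw [← id_whiskerRight, ← hF.2]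
  simp only [mulAt, cupAt, rightLoop]; monoidal

/-- The multiplication of the first three wires. -/
def mul : Op A A' where
  app w := match w with
    | Wire.up :: Wire.down :: Wire.up :: w => some ⟨Wire.up :: w, mulAt F (listObj A A' w)⟩
    | _ => none

theorem mul_comm_base (Q : Op A A') : mul F * sh 1 Q = sh 3 Q * mul F := by
  ext1; funext w
  rcases w with _ | ⟨x, _ | ⟨y, _ | ⟨z, w⟩⟩⟩
  · rfl
  · cases x <;> rfl
  · cases x <;> cases y <;> rfl
  rcases h : Q.app w with _ | ⟨w', f⟩
  · cases x <;> cases y <;> cases z <;> simp [sh, h, mul]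
  · cases x <;> cases y <;> cases z <;> simp [sh, h, mul]
    exact mulAt_naturality F f

theorem mul_mul : sh 2 (mul F) * mul F = mul F * mul F := by
  ext1; funext w
  rcases w with _ | ⟨x, _ | ⟨y, _ | ⟨z, w⟩⟩⟩
  · rfl
  · cases x <;> rfl
  · cases x <;> cases y <;> rfl
  rcases w with _ | ⟨x', _ | ⟨y', w⟩⟩
  · cases x <;> cases y <;> cases z <;> simp [sh, mul]
  · cases x <;> cases y <;> cases z <;> cases x' <;> simp [sh, mul]
  · cases x <;> cases y <;> cases z <;> cases x' <;> cases y' <;> simp [sh, mul]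
    exact mulAt_assoc F _

/-- The comultiplication of the first wire, when this is `up`. -/
def comul : Op A A' := sh 1 (cup Wire.down) * (sh 2 (cup Wire.up) * mul F)

/-- The symmetry equation. -/
theorem comul_eq : comul F = cup Wire.up * (sh 1 (cup Wire.down) * sh 2 (mul F)) := by
  ext1; funext w
  rcases w with _ | ⟨x, w⟩
  · simp [comul, sh, cup, mul]
  cases x <;> simp [comul, sh, cup, mul]
  exact mulAt_symm F _

theorem cup_mul (hF : F.Normal) : cup Wire.up * mul F = gd Wire.up := by
  ext1; funext w
  rcases w with _ | ⟨x, w⟩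
  · simp [cup, mul]
  cases x <;> simp [cup, mul, gd, listObj]
  exact congrArg (Sigma.mk _) (cupAt_mulAt F hF _)

theorem cup_mul' (hF : F.Normal) : sh 1 (cup Wire.down) * mul F = gd Wire.up := by
  ext1; funext w
  rcases w with _ | ⟨x, w⟩
  · simp [mul, sh]
  cases x <;> simp [cup, mul, sh, gd, listObj]
  exact congrArg (Sigma.mk _) (cupAt_mulAt' F hF _)

theorem maps_cup (x : Wire) : (cup (A := A) (A' := A') x).Maps [] [x, x.dual] := by
  intro w
  cases x <;> exact ⟨_, rfl⟩

theorem maps_comul : (comul F).Maps [Wire.up] [Wire.up, Wire.down, Wire.up] := by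
  intro w
  exact ⟨_, rfl⟩

end Op

end FrobeniusThree

namespace FrobeniusThree

open FrobeniusThreeStructure

variable {C : Type u} [Category.{v} C] [MonoidalCategory C] {A A' : C}

theorem mul_eq_mul_assoc {M : Type*} [Monoid M] {a b c d : M} (h : a * b = c * d) (e : M) :
    a * (b * e) = c * (d * e) := by
  rw [← mul_assoc, h, mul_assoc]

namespace Op

/-! ### Relations between the local operators -/

theorem gd_comm (x : Wire) (Q : Op A A') {i j : ℕ} (hj : i + 1 ≤ j) :
    sh i (gd x) * sh j Q = sh j Q * sh i (gd x) :=
  sh_comm (gd_comm_base x) Q hj rfl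

variable [ExactPairing A' A] [ExactPairing A A'] (F : FrobeniusThreeStructure A A')

theorem cup_comm (x : Wire) (Q : Op A A') {i j k : ℕ} (hj : i ≤ k) (hk : j = k + 2) :
    sh i (cup x) * sh j Q = sh k Q * sh i (cup x) :=
  sh_comm (cup_comm_base x) Q (by omega) (by omega)

theorem cap_comm (Q : Op A A') {i j k : ℕ} (hj : i ≤ j) (hk : k = j + 2) :
    sh i cap * sh j Q = sh k Q * sh i cap :=
  sh_comm cap_comm_base Q (by omega) (by omega)

theorem mul_comm (Q : Op A A') {i j k : ℕ} (hj : i + 1 ≤ j) (hk : k = j + 2) :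
    sh i (mul F) * sh j Q = sh k Q * sh i (mul F) :=
  sh_comm (mul_comm_base F) Q (by omega) (by omega)

theorem cup_cap_assoc (x : Wire) (i : ℕ) (Q : Op A A') :
    sh i (gd x) * (sh i (cup x) * (sh (i + 1) cap * Q)) = sh i (gd x) * Q := by
  rw [← sh_sh, ← mul_assoc, ← mul_assoc, mul_assoc (sh i (gd x)), ← map_mul, ← map_mul, cup_cap]

theorem cup_cap_assoc' (x : Wire) (i : ℕ) (Q : Op A A') :
    sh i (gd x) * (sh (i + 1) (cup x.dual) * (sh i cap * Q)) = sh i (gd x) * Q := by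
  rw [← sh_sh, ← mul_assoc, ← mul_assoc, mul_assoc (sh i (gd x)), ← map_mul, ← map_mul, cup_cap']

theorem mul_mul_assoc (i : ℕ) (Q : Op A A') :
    sh (i + 2) (mul F) * (sh i (mul F) * Q) = sh i (mul F) * (sh i (mul F) * Q) := by
  refine mul_eq_mul_assoc ?_ Q
  rw [← sh_sh, ← map_mul, ← map_mul, mul_mul]

/-- An equation between operators on the second wire of a cup holds on every wire of this kind,
because the first wire of the cup can be capped off. -/
theorem gd_mul_eq_of_cup_mul_eq {x : Wire} {P Q : Op A A'}
    (h : cup x * sh 1 P = cup x * sh 1 Q) : gd x.dual * P = gd x.dual * Q := by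
  have key (P : Op A A') : gd x.dual * P = gd x.dual * (sh 1 (cup x * sh 1 P) * cap) := by
    have h₁ := cup_cap_assoc' x.dual 0 P
    rw [Wire.dual_dual] at h₁
    rw [map_mul, sh_sh, mul_assoc, ← sh_zero cap,
      ← cap_comm (i := 0) (j := 0) P le_rfl rfl]
    exact h₁.symm
  rw [key P, h, ← key]

theorem comul_gd : comul F * gd Wire.up = comul F := by
  have h : mul F * gd Wire.up = mul F := by
    ext1; funext w
    rcases w with _ | ⟨x, _ | ⟨y, _ | ⟨z, w⟩⟩⟩
    · rfl
    · cases x <;> rfl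
    · cases x <;> cases y <;> rfl
    · cases x <;> cases y <;> cases z <;> simp [mul, listObj, wireObj]
  rw [comul, mul_assoc, mul_assoc, h]

/-- The comultiplication of `down`, obtained from that of `up` by a quarter turn. -/
def comulDown : Op A A' := sh 1 (cup Wire.up) * (sh 1 (comul F) * cap)

theorem maps_comulDown : (comulDown F).Maps [Wire.down] [Wire.down, Wire.up, Wire.down] :=
  fun _ => ⟨_, rfl⟩

theorem cup_comul : cup Wire.up * comul F = cup Wire.up * sh 1 (comulDown F) := by
  have h₁ := cup_comm (A := A) (A' := A') Wire.up (cup Wire.up) (i := 0) (j := 2) le_rfl rfl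
  have h₂ := cup_comm Wire.up (comul F) (i := 0) (j := 2) le_rfl rfl
  have h₃ := cup_cap_assoc (A := A) (A' := A') Wire.up 0 1
  rw [sh_zero] at h₁ h₂
  rw [mul_one, mul_one, sh_zero] at h₃
  rw [comulDown, map_mul, map_mul, sh_sh, sh_sh, mul_eq_mul_assoc h₁, mul_eq_mul_assoc h₂,
    sh_zero, ← comul_gd, mul_assoc (comul F)]
  exact congrArg (fun Q => cup Wire.up * (comul F * Q)) h₃.symm

/-- The comultiplication is invariant under half turns: this is the place where its two
descriptions, by bending inputs of the multiplication to the right and to the left, are played off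
against each other. -/
theorem cup_comulDown : cup Wire.down * comulDown F = cup Wire.down * sh 1 (comul F) := by
  have hmaps : (cup Wire.down * sh 1 (cup Wire.up)).Maps (A := A) (A' := A') []
      ([] ++ Wire.down :: [Wire.up, Wire.down, Wire.up]) :=
    (maps_cup Wire.down).mul ((maps_cup Wire.up).sh [Wire.down] [Wire.up])
  have hgd := hmaps.mul_gd
  calc cup Wire.down * comulDown F
      = cup Wire.down * (sh 1 (cup Wire.up) * (sh 1 (cup Wire.up) * (sh 2 (cup Wire.down) *
          (sh 3 (mul F) * sh 0 cap)))) := by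
        rw [comulDown, comul_eq]; simp only [map_mul, sh_sh, mul_assoc, sh_zero]
    _ = (cup Wire.down * sh 1 (cup Wire.up)) * (sh 1 (cup Wire.up) * (sh 0 cap *
          (cup Wire.down * sh 1 (mul F)))) := by
        rw [← cap_comm (mul F) (i := 0) (j := 1) (by omega) rfl,
          ← mul_eq_mul_assoc (cap_comm (cup Wire.down) (i := 0) (j := 0) le_rfl rfl), mul_assoc]
        rfl
    _ = (cup Wire.down * sh 1 (cup Wire.up)) * (cup Wire.down * sh 1 (mul F)) := by
        rw [← hgd, mul_assoc _ (sh _ (gd _)), mul_assoc _ (sh _ (gd _))]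
        exact congrArg _ (cup_cap_assoc' Wire.down 0 _)
    _ = cup Wire.down * (sh 0 (cup Wire.down) * (sh 3 (cup Wire.up) * sh 1 (mul F))) := by
        rw [mul_assoc, mul_eq_mul_assoc (cup_comm Wire.down (cup Wire.up) (i := 0) (j := 3) (k := 1)
          (by omega) rfl)]
        rfl
    _ = _ := by
        have h := cup_comm (A := A) (A' := A') Wire.down (cup Wire.down) (i := 0) (j := 2) le_rfl
          rfl
        rw [comul, map_mul, map_mul, sh_sh, sh_sh]
        exact (mul_eq_mul_assoc h _).symm

/-- By associativity, comultiplying the first wire again amounts to comultiplying the middle one. -/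
theorem comul_comul_left : comul F * comul F = comul F * sh 1 (comulDown F) := by
  have h₁ := mul_comm F (cup Wire.down) (i := 0) (j := 1) le_rfl rfl
  have h₂ := mul_comm F (cup Wire.up) (i := 0) (j := 2) (by omega) rfl
  have h₃ := mul_mul_assoc F 0 1
  have h₄ := mul_comm F (comulDown F) (i := 0) (j := 1) le_rfl rfl
  simp only [sh_zero, mul_one, Nat.zero_add, Nat.reduceAdd] at h₁ h₂ h₃ h₄
  calc comul F * comul F
      = sh 1 (cup Wire.down) * (sh 2 (cup Wire.up) * (mul F * (sh 1 (cup Wire.down) *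
          (sh 2 (cup Wire.up) * mul F)))) := by simp only [comul, mul_assoc]
    _ = sh 1 (cup Wire.down) * (sh 2 (cup Wire.up) * (sh 3 (cup Wire.down) * (sh 4 (cup Wire.up) *
          (sh 2 (mul F) * mul F)))) := by
        rw [mul_eq_mul_assoc h₁, mul_eq_mul_assoc h₂, h₃]
    _ = sh 1 (cup Wire.down) * (sh 2 (cup Wire.up * comul F) * mul F) := by
        simp only [comul, map_mul, sh_sh, mul_assoc]
    _ = sh 1 (cup Wire.down) * (sh 2 (cup Wire.up) * (sh 3 (comulDown F) * mul F)) := by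
        rw [cup_comul, map_mul, sh_sh, mul_assoc]
    _ = _ := by
        rw [← h₄]; simp only [comul, mul_assoc]

/-- By associativity, comultiplying the last wire again amounts to comultiplying the middle one. -/
theorem comul_comul_right : comul F * sh 2 (comul F) = comul F * sh 1 (comulDown F) := by
  have h₁ := cup_comm Wire.up (mul F) (i := 2) (j := 4) le_rfl rfl
  have h₂ := cup_comm Wire.down (mul F) (i := 3) (j := 6) (k := 4) (by omega) rfl
  have h₃ := mul_mul_assoc F 4 1
  have h₄ := fun x => cup_comm x (mul F) (i := 1) (j := 4) (k := 2) (by omega) rfl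
  have h₅ : sh 1 (comulDown F) * sh 4 (mul F) = sh 2 (mul F) * sh 1 (comulDown F) := by
    have h₁ := cup_comm Wire.up (mul F) (i := 2) (j := 4) le_rfl rfl
    have h₂ : sh 2 (comul F) * sh 6 (mul F) = sh 4 (mul F) * sh 2 (comul F) := by
      have h₁ := cup_comm Wire.down (mul F) (i := 3) (j := 6) (k := 4) (by omega) rfl
      have h₂ := cup_comm Wire.up (mul F) (i := 4) (j := 8) (k := 6) (by omega) rfl
      have h₃ := mul_comm F (mul F) (i := 2) (j := 6) (k := 8) (by omega) rfl
      simp only [comul, map_mul, sh_sh, mul_assoc, h₃]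
      rw [mul_eq_mul_assoc h₂, mul_eq_mul_assoc h₁]
    have h₃ := cap_comm (mul F) (i := 1) (j := 4) (k := 6) (by omega) rfl
    simp only [comulDown, map_mul, sh_sh, mul_assoc, h₃]
    rw [mul_eq_mul_assoc h₂, mul_eq_mul_assoc h₁]
  simp only [mul_one] at h₃
  calc comul F * sh 2 (comul F)
      = cup Wire.up * (sh 1 (cup Wire.down) * (sh 2 (mul F) * (sh 2 (cup Wire.up) *
          (sh 3 (cup Wire.down) * sh 4 (mul F))))) := by
        rw [comul_eq]; simp only [map_mul, sh_sh, mul_assoc]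
    _ = cup Wire.up * (sh 1 (cup Wire.down) * (sh 2 (cup Wire.up) * (sh 3 (cup Wire.down) *
          (sh 4 (mul F) * sh 4 (mul F))))) := by
        rw [← mul_eq_mul_assoc h₁, ← mul_eq_mul_assoc h₂, h₃]
    _ = cup Wire.up * (sh 1 (cup Wire.down * sh 1 (comul F)) * sh 4 (mul F)) := by
        rw [comul_eq]; simp only [map_mul, sh_sh, mul_assoc]
    _ = cup Wire.up * (sh 1 (cup Wire.down) * (sh 1 (comulDown F) * sh 4 (mul F))) := by
        rw [← cup_comulDown, map_mul, mul_assoc]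
    _ = _ := by
        rw [h₅, comul_eq]; simp only [mul_assoc]

/-- The comultiplication of the first wire, of either kind. -/
def fork : Op A A' where
  app w := match w with
    | [] => none
    | Wire.up :: w => (comul F).app (Wire.up :: w)
    | Wire.down :: w => (comulDown F).app (Wire.down :: w)

theorem gd_fork_up : gd Wire.up * fork F = gd Wire.up * comul F := gd_mul_ext fun _ => rfl

theorem gd_fork_down : gd Wire.down * fork F = gd Wire.down * comulDown F := gd_mul_ext fun _ => rfl

theorem maps_fork (x : Wire) : (fork F).Maps [x] [x, x.dual, x] := by
  cases x
  · exact maps_comul F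
  · exact maps_comulDown F

/-- The comultiplication of a wire of known kind yields wires of known kinds. -/
theorem gd_fork_gd (x : Wire) (Q : Op A A') :
    gd x * (fork F * (gd x * Q)) = gd x * (fork F * Q) := by
  have h := (maps_fork F x).gd_mul_gd (u := []) (r := [x.dual, x])
  rw [List.length_nil, sh_zero] at h
  simpa only [mul_assoc] using congrArg (· * Q) h

theorem gd_fork_gd₁ (x : Wire) (Q : Op A A') :
    gd x * (fork F * (sh 1 (gd x.dual) * Q)) = gd x * (fork F * Q) := by
  have h : gd x * (fork F * sh 1 (gd x.dual)) = gd x * fork F :=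
    (maps_fork F x).gd_mul_gd (u := [x]) (r := [x])
  simpa only [mul_assoc] using congrArg (· * Q) h

theorem gd_fork_gd₂ (x : Wire) (Q : Op A A') :
    gd x * (fork F * (sh 2 (gd x) * Q)) = gd x * (fork F * Q) := by
  have h : gd x * (fork F * sh 2 (gd x)) = gd x * fork F :=
    (maps_fork F x).gd_mul_gd (u := [x, x.dual]) (r := [])
  simpa only [mul_assoc] using congrArg (· * Q) h

theorem fork_comm_base (Q : Op A A') : fork F * sh 3 Q = sh 1 Q * fork F := by
  have h₁ (i j k) (hj : i + 1 ≤ k) (hk : j = k + 2) :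
      sh i (comul F) * sh j Q = sh k Q * sh i (comul F) := by
    subst hk
    simp only [comul, map_mul, sh_sh, mul_assoc]
    rw [mul_comm F Q (i := i) (j := k + 2) (k := k + 4) (by omega) rfl,
      mul_eq_mul_assoc (cup_comm Wire.up Q (i := i + 2) (j := k + 4) (by omega) rfl),
      mul_eq_mul_assoc (cup_comm Wire.down Q (i := i + 1) (j := k + 2) (by omega) rfl)]
  have h₂ := cap_comm Q (i := 0) (j := 3) (by omega) rfl
  have h₃ := cup_comm Wire.up Q (i := 1) (j := 3) (by omega) rfl
  have h₄ := h₁ 0 3 1 le_rfl rfl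
  simp only [sh_zero] at h₂ h₄
  refine ext_gd rfl fun x => ?_
  rw [← mul_assoc, mul_eq_mul_assoc (gd_comm_base x Q)]
  cases x
  · rw [gd_fork_up, mul_assoc, h₄, mul_eq_mul_assoc (gd_comm_base _ Q)]
  · rw [gd_fork_down, ← mul_eq_mul_assoc (gd_comm_base _ Q), mul_assoc, comulDown]
    simp only [mul_assoc, h₂]
    rw [mul_eq_mul_assoc (h₁ 1 5 3 (by omega) rfl), mul_eq_mul_assoc h₃]

theorem fork_comm (Q : Op A A') {i j k : ℕ} (hj : i + 1 ≤ k) (hk : j = k + 2) :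
    sh i (fork F) * sh j Q = sh k Q * sh i (fork F) :=
  sh_comm (fork_comm_base F) Q (by omega) (by omega)

/-- Both wires of a cup can be comultiplied with the same result. -/
theorem cup_fork (x : Wire) : cup x * sh 1 (fork F) = cup x * fork F := by
  have h₁ : cup x * sh 1 (fork F) = cup x * sh 1 (gd x.dual * fork F) := by
    rw [map_mul, ← mul_assoc, cup_gd']
  have h₂ : cup x * fork F = cup x * (gd x * fork F) := by rw [← mul_assoc, cup_gd]
  rw [h₁, h₂]
  cases x
  · rw [gd_fork_up, Wire.dual, gd_fork_down, map_mul, ← mul_assoc, ← mul_assoc, cup_gd, cup_comul]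
    exact congrArg (· * _) (cup_gd' Wire.up)
  · rw [gd_fork_down, Wire.dual, gd_fork_up, map_mul, ← mul_assoc, ← mul_assoc, cup_gd,
      cup_comulDown]
    exact congrArg (· * _) (cup_gd' Wire.down)

/-- Two successive comultiplications of the same wire agree wherever the second one is done. For
`up`, this comes from associativity; the relation for `down` follows by turning it along a cup. -/
theorem gd_fork_fork (x : Wire) :
    gd x * (fork F * sh 1 (fork F)) = gd x * (fork F * fork F) ∧
      gd x * (fork F * sh 2 (fork F)) = gd x * (fork F * fork F) := by
  have hup : gd Wire.up * (fork F * sh 1 (fork F)) = gd Wire.up * (fork F * fork F) ∧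
      gd Wire.up * (fork F * sh 2 (fork F)) = gd Wire.up * (fork F * fork F) := by
    have h₀ : gd Wire.up * (fork F * fork F) = gd Wire.up * (comul F * comul F) := by
      rw [← gd_fork_gd, gd_fork_up, gd_fork_gd, ← mul_assoc, gd_fork_up, mul_assoc]
    have h₁ : gd Wire.up * (fork F * sh 1 (fork F)) =
        gd Wire.up * (comul F * sh 1 (comulDown F)) := by
      rw [← gd_fork_gd₁, ← map_mul, Wire.dual, gd_fork_down, map_mul]
      refine (gd_fork_gd₁ F Wire.up _).trans ?_
      rw [← mul_assoc, gd_fork_up, mul_assoc]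
    have h₂ : gd Wire.up * (fork F * sh 2 (fork F)) = gd Wire.up * (comul F * sh 2 (comul F)) := by
      rw [← gd_fork_gd₂, ← map_mul, gd_fork_up, map_mul, gd_fork_gd₂, ← mul_assoc, gd_fork_up,
        mul_assoc]
    rw [h₀, h₁, h₂, comul_comul_left, comul_comul_right]
    exact ⟨rfl, rfl⟩
  cases x
  · exact hup
  have hcup (Q : Op A A') :
      cup Wire.up * (fork F * Q) = cup Wire.up * (gd Wire.up * (fork F * Q)) := by
    rw [← mul_assoc (cup _) (gd _), cup_gd]
  have h₀ : cup Wire.up * sh 1 (fork F * fork F) = cup Wire.up * (fork F * fork F) := by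
    rw [map_mul, mul_eq_mul_assoc (cup_fork F _), hcup, hup.1, ← hcup]
  have h₁ : cup Wire.up * sh 1 (fork F * sh 1 (fork F)) = cup Wire.up * (fork F * fork F) := by
    rw [map_mul, mul_eq_mul_assoc (cup_fork F _), hcup, sh_sh, hup.2, ← hcup]
  have h₂ : cup Wire.up * sh 1 (fork F * sh 2 (fork F)) = cup Wire.up * (fork F * fork F) := by
    have h := fork_comm F (fork F) (i := 0) (j := 3) le_rfl rfl
    rw [map_mul, mul_eq_mul_assoc (cup_fork F _), sh_sh]
    exact (congrArg _ h).trans (mul_eq_mul_assoc (cup_fork F _) _)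
  exact ⟨gd_mul_eq_of_cup_mul_eq (h₁.trans h₀.symm), gd_mul_eq_of_cup_mul_eq (h₂.trans h₀.symm)⟩

theorem fork_fork₁ : fork F * sh 1 (fork F) = fork F * fork F :=
  ext_gd rfl fun x => (gd_fork_fork F x).1

theorem fork_fork₂ : fork F * sh 2 (fork F) = fork F * fork F :=
  ext_gd rfl fun x => (gd_fork_fork F x).2

theorem comul_cap (hF : F.Normal) : comul F * cap = gd Wire.up := by
  have h₁ := cap_comm (mul F) (i := 0) (j := 0) le_rfl rfl
  rw [comul_eq, mul_assoc, mul_assoc, ← cup_mul F hF]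
  rw [sh_zero, sh_zero] at h₁
  rw [← h₁, ← cup_gd, mul_assoc, mul_assoc]
  exact congrArg _ (cup_cap_assoc' Wire.up 0 _)

theorem comul_cap' (hF : F.Normal) : comul F * sh 1 cap = gd Wire.up := by
  have h₁ := mul_comm F cap (i := 0) (j := 1) le_rfl rfl
  rw [sh_zero] at h₁
  have h₂ : sh 1 (cup Wire.down) * sh 2 (gd Wire.up) =
      sh 1 (cup (A := A) (A' := A') Wire.down) := by
    rw [← sh_sh 1 1, ← map_mul]
    exact congrArg _ (cup_gd' Wire.down)
  rw [comul, mul_assoc, mul_assoc, h₁, ← h₂, mul_assoc]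
  refine (congrArg _ (cup_cap_assoc Wire.up 2 (mul F))).trans ?_
  rw [← mul_assoc, h₂, cup_mul' F hF]

/-- In a normal structure, capping off two adjacent results of a comultiplication undoes it. -/
theorem gd_fork_cap (hF : F.Normal) (x : Wire) :
    gd x * (fork F * cap) = gd x ∧ gd x * (fork F * sh 1 cap) = gd x := by
  have hgd (y : Wire) : gd y * gd y = gd (A := A) (A' := A') y := by
    have := gd_mul_ext (x := y) (O := gd (A := A) (A' := A') y) (P := 1) fun w => by simp
    rwa [mul_one] at this
  have hup : gd Wire.up * (fork F * cap) = gd Wire.up ∧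
      gd Wire.up * (fork F * sh 1 cap) = gd Wire.up := by
    rw [← mul_assoc, ← mul_assoc, gd_fork_up, mul_assoc, mul_assoc, comul_cap F hF,
      comul_cap' F hF]
    exact ⟨hgd _, hgd _⟩
  cases x
  · exact hup
  constructor
  · have h : cup Wire.up * sh 1 (fork F * cap) = cup Wire.up * sh 1 1 := by
      rw [map_mul, mul_eq_mul_assoc (cup_fork F _), ← cup_gd, mul_assoc, hup.2, map_one, mul_one]
    have := gd_mul_eq_of_cup_mul_eq h
    rwa [mul_one] at this
  · have h₁ : cup Wire.down * (fork F * sh 1 cap) = cup Wire.down := by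
      rw [← mul_eq_mul_assoc (cup_fork F _), ← map_mul, ← cup_gd', mul_assoc, ← map_mul]
      exact congrArg (fun Q => cup Wire.down * sh 1 Q) hup.1
    have h₂ := cap_comm (A := A) (A' := A') cap (i := 1) (j := 1) le_rfl rfl
    have h₃ := fork_comm F cap (i := 0) (j := 3) le_rfl rfl
    have h₄ := cup_cap_assoc (A := A) (A' := A') Wire.down 0
    simp only [sh_zero, Nat.zero_add] at h₃ h₄
    rw [← h₄, ← mul_eq_mul_assoc h₃, ← h₂, ← mul_assoc (fork F),
      ← mul_assoc (cup _), h₁]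
    have := h₄ 1
    rwa [mul_one, mul_one] at this

/-- The multiplication in terms of the comultiplication. -/
theorem mul_eq_fork : sh 2 (gd Wire.up) * (sh 1 (gd Wire.down) * (gd Wire.up *
      (fork F * (sh 2 cap * sh 1 cap)))) =
    sh 2 (gd Wire.up) * (sh 1 (gd Wire.down) * (gd Wire.up * mul F)) := by
  have h₁ := mul_comm F cap (i := 0) (j := 2) (by omega) rfl
  have h₂ := mul_comm F cap (i := 0) (j := 1) le_rfl rfl
  have h₃ := cup_comm (A := A) (A' := A') Wire.up cap (i := 2) (j := 4) le_rfl rfl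
  have h₄ := gd_comm (A := A) (A' := A') Wire.down (gd Wire.up) (i := 1) (j := 2) le_rfl
  have h₅ := gd_comm (A := A) (A' := A') Wire.up (gd Wire.up) (i := 0) (j := 2) (by omega)
  have h₆ := gd_comm (A := A) (A' := A') Wire.up (gd Wire.down) (i := 0) (j := 1) le_rfl
  have h₇ := cup_cap_assoc (A := A) (A' := A') Wire.down 1
  have h₈ := cup_cap_assoc (A := A) (A' := A') Wire.up 2
  simp only [sh_zero, Nat.reduceAdd] at h₁ h₂ h₅ h₆ h₇ h₈
  calc _ = sh 2 (gd Wire.up) * (sh 1 (gd Wire.down) * (gd Wire.up * (sh 1 (cup Wire.down) *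
          (sh 2 cap * (sh 2 (cup Wire.up) * (sh 3 cap * mul F)))))) := by
        rw [mul_eq_mul_assoc (gd_fork_up F), comul]
        simp only [mul_assoc]
        rw [mul_eq_mul_assoc h₁, mul_eq_mul_assoc h₃, h₂]
    _ = gd Wire.up * (sh 1 (gd Wire.down) * (sh 2 (gd Wire.up) * mul F)) := by
        rw [← mul_eq_mul_assoc h₆, h₇, ← mul_eq_mul_assoc h₅, ← mul_eq_mul_assoc h₄, h₈]
    _ = _ := by
        rw [mul_eq_mul_assoc h₄, mul_eq_mul_assoc h₅, mul_eq_mul_assoc h₆]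

end Op

end FrobeniusThree

namespace FrobeniusThree

open FrobeniusThreeStructure

/-! ### Alternating words -/

/-- The alternating word of length `n` that begins with `x`. -/
def alt (x : Wire) : ℕ → List Wire
  | 0 => []
  | n + 1 => x :: alt x.dual n

@[simp] theorem length_alt (x : Wire) (n : ℕ) : (alt x n).length = n := by
  induction n generalizing x with
  | zero => rfl
  | succ n ih => simp [alt, ih]

theorem alt_add_two (x : Wire) (n : ℕ) : alt x (n + 2) = x :: x.dual :: alt x n := by
  simp [alt]

theorem alt_insert {x y : Wire} {n : ℕ} {p q : List Wire} (h : alt x n = p ++ y :: q) :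
    alt x (n + 2) = p ++ y :: y.dual :: y :: q := by
  induction p generalizing x n with
  | nil =>
    cases n with
    | zero => simp [alt] at h
    | succ n =>
      obtain ⟨rfl, rfl⟩ : x = y ∧ alt x.dual n = q := by simpa [alt] using h
      simp [alt]
  | cons z p ih =>
    cases n with
    | zero => simp [alt] at h
    | succ n =>
      obtain ⟨rfl, h'⟩ : x = z ∧ alt x.dual n = p ++ y :: q := by simpa [alt] using h
      rw [Nat.succ_add, alt, ih h', List.cons_append]

theorem alt_remove {x y z : Wire} {n : ℕ} {p q : List Wire}
    (h : alt x (n + 2) = p ++ y :: z :: q) : alt x n = p ++ q := by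
  induction p generalizing x n with
  | nil =>
    rw [alt_add_two, List.nil_append, List.cons.injEq, List.cons.injEq] at h
    obtain ⟨rfl, -, rfl⟩ := h
    rfl
  | cons a p ih =>
    cases n with
    | zero => exact absurd (congrArg List.length h) (by simp; omega)
    | succ n =>
      obtain ⟨rfl, h'⟩ : x = a ∧ alt x.dual (n + 2) = p ++ y :: z :: q := by
        rw [Nat.succ_add, alt] at h; simpa using h
      rw [alt, ih h', List.cons_append]

theorem alt_odd_append (x : Wire) (m : ℕ) : alt x (2 * m + 2) = alt x (2 * m + 1) ++ [x.dual] := by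
  induction m with
  | zero => rfl
  | succ m ih =>
    rw [show 2 * (m + 1) + 2 = 2 * m + 2 + 2 by ring, alt_add_two, ih,
      show 2 * (m + 1) + 1 = 2 * m + 1 + 2 by ring, alt_add_two]
    rfl

/-! ### Canonical blocks -/

variable {C : Type u} [Category.{v} C] [MonoidalCategory C] {A A' : C}
variable [ExactPairing A' A] [ExactPairing A A'] (F : FrobeniusThreeStructure A A')

namespace Op

/-- The canonical connected diagram without inputs whose output is the alternating word of
length `2 * m + 2` that begins with `x`: a cup whose first wire is comultiplied `m` times. -/
def blk (x : Wire) (m : ℕ) : Op A A' := cup x * fork F ^ m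

theorem blk_succ (x : Wire) (m : ℕ) : blk F x (m + 1) = blk F x m * fork F := by
  rw [blk, pow_succ, ← mul_assoc, blk]

theorem maps_blk (x : Wire) (m : ℕ) : (blk F x m).Maps [] (alt x (2 * m + 2)) := by
  induction m with
  | zero => simpa [blk, alt] using maps_cup x
  | succ m ih =>
    rw [blk_succ]
    have := (maps_fork F x).sh [] (x.dual :: alt x (2 * m))
    refine ih.mul ?_
    rw [show 2 * (m + 1) + 2 = 2 * m + 2 + 2 by ring, alt_add_two, alt_add_two, alt_add_two]
    exact this

theorem blk_comm (x : Wire) (m : ℕ) (Q : Op A A') {i j k : ℕ} (hj : i ≤ k)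
    (hk : j = k + (2 * m + 2)) :
    sh i (blk F x m) * sh j Q = sh k Q * sh i (blk F x m) := by
  subst hk
  induction m with
  | zero => simpa [blk] using cup_comm x Q hj rfl
  | succ m ih =>
    rw [blk_succ, map_mul, mul_assoc, fork_comm F Q (j := k + (2 * (m + 1) + 2))
      (k := k + (2 * m + 2)) (by omega) (by omega), ← mul_assoc, ih, mul_assoc]

/-- All comultiplications of a canonical block are canonical blocks. -/
theorem blk_fork (x : Wire) {m i : ℕ} (hi : i < 2 * m + 2) :
    blk F x m * sh i (fork F) = blk F x (m + 1) := by
  rcases i with _ | _ | _ | i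
  · rw [blk_succ, sh_zero]
  · cases m with
    | zero => simpa [blk] using cup_fork F x
    | succ m => rw [blk_succ, mul_assoc, fork_fork₁, ← mul_assoc, ← blk_succ, ← blk_succ]
  · cases m with
    | zero => omega
    | succ m => rw [blk_succ, mul_assoc, fork_fork₂, ← mul_assoc, ← blk_succ, ← blk_succ]
  · induction m generalizing i with
    | zero => omega
    | succ m ih =>
      have h := fork_comm F (fork F) (i := 0) (j := i + 3) (k := i + 1) (by omega) rfl
      rw [sh_zero] at h
      rw [blk_succ, mul_assoc, h, ← mul_assoc]
      rcases i with _ | _ | i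
      · cases m with
        | zero => simp only [blk, pow_zero, mul_one, Nat.zero_add, cup_fork, pow_succ, mul_assoc,
            one_mul]
        | succ m =>
          rw [blk_succ, mul_assoc (blk F x m), fork_fork₁]
          simp only [blk_succ, mul_assoc]
      · cases m with
        | zero => omega
        | succ m =>
          rw [blk_succ, mul_assoc (blk F x m), fork_fork₂]
          simp only [blk_succ, mul_assoc]
      · rw [ih i (by omega), ← blk_succ]

theorem exists_blk_gd (x : Wire) {m i : ℕ} (hi : i < 2 * m + 2) :
    ∃ y, blk F x m * sh i (gd y) = blk F x m := by
  have h : i < (alt x (2 * m + 2)).length := by simpa using hi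
  have hm := maps_blk F x m
  rw [← List.take_append_drop i (alt x (2 * m + 2)), List.drop_eq_getElem_cons h] at hm
  have := hm.mul_gd
  rw [List.length_take, Nat.min_eq_left h.le] at this
  exact ⟨_, this⟩

/-- In a normal structure, capping off two adjacent wires of a canonical block yields a canonical
block. -/
theorem blk_cap (hF : F.Normal) (x : Wire) {m i : ℕ} (hi : i < 2 * m + 3) :
    blk F x (m + 1) * sh i cap = blk F x m := by
  rcases Nat.lt_or_ge i (2 * m + 2) with h | h
  · obtain ⟨y, hy⟩ := exists_blk_gd F x h
    rw [← blk_fork F x h, mul_assoc, ← map_mul, ← hy, mul_assoc, ← map_mul,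
      (gd_fork_cap F hF y).1]
  · obtain rfl : i = 2 * m + 1 + 1 := by omega
    have h : 2 * m + 1 < 2 * m + 2 := by omega
    obtain ⟨y, hy⟩ := exists_blk_gd F x h
    rw [← blk_fork F x h, mul_assoc, ← sh_sh _ 1 cap, ← map_mul, ← hy, mul_assoc, ← map_mul,
      (gd_fork_cap F hF y).2]

/-- Joining a canonical block to a wire on its left comultiplies this wire. -/
theorem gd_blk_cap (x : Wire) (m : ℕ) :
    gd x * (sh 1 (blk F x.dual m) * cap) = gd x * fork F ^ m := by
  induction m with
  | zero => simpa [blk] using cup_cap' x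
  | succ m ih =>
    have h := cap_comm (fork F) (i := 0) (j := 0) le_rfl rfl
    rw [sh_zero, sh_zero] at h
    rw [← blk_fork F x.dual (i := 1) (by omega), map_mul, sh_sh, mul_assoc, ← h,
      ← mul_assoc (sh 1 _), ← mul_assoc, ih, pow_succ, mul_assoc]

/-- Joining a canonical block to a wire on its right comultiplies this wire. -/
theorem gd_blk_cap' (x : Wire) (m : ℕ) :
    gd x * (blk F x m * sh (2 * m + 1) cap) = gd x * fork F ^ m := by
  induction m with
  | zero => simpa [blk] using cup_cap x
  | succ m ih =>
    have h := fork_comm F cap (i := 0) (j := 2 * (m + 1) + 1) (k := 2 * m + 1) (by omega) rfl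
    rw [sh_zero] at h
    rw [blk_succ, mul_assoc, h, ← mul_assoc (blk F x m), ← mul_assoc, ih, pow_succ, mul_assoc]

end Op

/-! ### Planar arrangements of canonical blocks -/

open Op

/-- The colourings obtained from those satisfying `Col` by inserting `l` entries of one and the same
colour at position `i`. -/
def insCol (i l : ℕ) (Col : List Bool → Prop) (c : List Bool) : Prop :=
  ∃ cu cv b, cu.length = i ∧ c = cu ++ (List.replicate l b ++ cv) ∧ Col (cu ++ cv)

/-- `Planar F w Col n e` says that the operator `e` inserts the word `w` by a planar arrangement of
`n` canonical blocks, in which each block is inserted at some position between the wires of the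
previous ones. `Col` holds for the colourings of the wires of `w` that are constant on each
block: this records which wires belong to the same block. -/
inductive Planar : List Wire → (List Bool → Prop) → ℕ → Op A A' → Prop
  | nil : Planar [] (fun c => c = []) 0 1
  | ins {u v : List Wire} {Col : List Bool → Prop} {n : ℕ} {e : Op A A'} (x : Wire) (m : ℕ)
      (h : Planar (u ++ v) Col n e) :
      Planar (u ++ (alt x (2 * m + 2) ++ v)) (insCol u.length (2 * m + 2) Col) (n + 1)
        (e * sh u.length (blk F x m))

theorem append_eq_append_cons {α : Type*} {B u₀ v₀ u v : List α} {x : α}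
    (h : u₀ ++ (B ++ v₀) = u ++ x :: v) :
    (∃ a, u₀ = u ++ x :: a ∧ v = a ++ (B ++ v₀)) ∨
      (∃ p q, B = p ++ x :: q ∧ u = u₀ ++ p ∧ v = q ++ v₀) ∨
      ∃ p, u = u₀ ++ (B ++ p) ∧ v₀ = p ++ x :: v := by
  have aux {a b c : List α} (h : a ++ b = x :: c) :
      (a = [] ∧ b = x :: c) ∨ ∃ t, a = x :: t ∧ c = t ++ b := by
    cases a with
    | nil => exact Or.inl ⟨rfl, h⟩
    | cons y t =>
      obtain ⟨rfl, rfl⟩ : y = x ∧ t ++ b = c := by simpa using h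
      exact Or.inr ⟨t, rfl, rfl⟩
  have aux' {a b : List α} (h : a ++ b = u ++ x :: v) :
      (∃ t, a = u ++ x :: t ∧ v = t ++ b) ∨ ∃ t, u = a ++ t ∧ b = t ++ x :: v := by
    rcases List.append_eq_append_iff.1 h with ⟨t, rfl, rfl⟩ | ⟨t, rfl, h'⟩
    · exact Or.inr ⟨t, rfl, rfl⟩
    · rcases aux h'.symm with ⟨rfl, rfl⟩ | ⟨t, rfl, rfl⟩
      · exact Or.inr ⟨[], by simp, rfl⟩
      · exact Or.inl ⟨t, rfl, rfl⟩
  rcases aux' h with h₁ | ⟨t, rfl, h₁⟩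
  · exact Or.inl h₁
  rcases List.append_eq_append_iff.1 h₁ with ⟨s, rfl, h'⟩ | ⟨s, rfl, h'⟩
  · exact Or.inr (Or.inr ⟨s, rfl, h'⟩)
  · rcases aux h'.symm with ⟨rfl, rfl⟩ | ⟨s, rfl, rfl⟩
    · exact Or.inr (Or.inr ⟨[], by simp, rfl⟩)
    · exact Or.inr (Or.inl ⟨t, s, rfl, rfl, rfl⟩)

theorem exists_of_append_eq_append {α : Type*} {a b c d : List α} (h : a ++ b = c ++ d)
    (hl : c.length ≤ a.length) : ∃ t, a = c ++ t ∧ d = t ++ b := by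
  rcases List.append_eq_append_iff.1 h with ⟨t, rfl, rfl⟩ | ⟨t, rfl, rfl⟩
  · obtain rfl : t = [] := by
      rw [List.length_append] at hl
      exact List.length_eq_zero_iff.1 (by omega)
    exact ⟨[], by simp, rfl⟩
  · exact ⟨t, rfl, rfl⟩

namespace Planar

variable {F} {w : List Wire} {Col : List Bool → Prop} {n : ℕ} {e : Op A A'}

theorem congr {w' : List Wire} {e' : Op A A'} (h : Planar F w Col n e) (hw : w = w') (he : e = e') :
    Planar F w' Col n e' := by
  subst hw he; exact h

theorem maps (h : Planar F w Col n e) : e.Maps [] w := by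
  induction h with
  | nil => exact fun w => ⟨𝟙 _, rfl⟩
  | @ins u v _ _ _ x m _ ih =>
    have h := (maps_blk F x m).sh u v
    rw [List.nil_append] at h
    exact ih.mul h

theorem mul_gd {u v : List Wire} {x : Wire} (h : Planar F w Col n e) (hw : w = u ++ x :: v) :
    e * sh u.length (gd x) = e := by
  subst hw
  exact h.maps.mul_gd

theorem length_eq (h : Planar F w Col n e) {c : List Bool} (hc : Col c) : c.length = w.length := by
  induction h generalizing c with
  | nil => subst hc; rfl
  | ins x m _ ih =>
    obtain ⟨cu, cv, b, hu, rfl, hc⟩ := hc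
    have := ih hc
    simp only [List.length_append, List.length_replicate, length_alt] at this ⊢
    omega

theorem col_false (h : Planar F w Col n e) : Col (List.replicate w.length false) := by
  induction h with
  | nil => rfl
  | @ins u v _ _ _ x m _ ih =>
    refine ⟨List.replicate u.length false, List.replicate v.length false, false, by simp, ?_, ?_⟩
    · simp only [List.length_append, length_alt, List.replicate_add]
    · rwa [← List.replicate_add, ← List.length_append]

theorem eq_nil (h : Planar F w Col 0 e) : w = [] ∧ e = 1 := by
  cases h
  exact ⟨rfl, rfl⟩

theorem eq_zero (h : Planar F [] Col n e) : n = 0 := by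
  generalize hw : [] = w at h
  cases h with
  | nil => rfl
  | ins x m h => exact absurd (congrArg List.length hw) (by simp; omega)

/-- An arrangement of at least two blocks has a non-constant colouring. -/
theorem exists_col (h : Planar F w Col n e) (hn : 2 ≤ n) : ∃ c, Col c ∧ true ∈ c ∧ false ∈ c := by
  cases h with
  | nil => omega
  | @ins u v _ n e x m h =>
    have hne : u.length + v.length ≠ 0 := by
      intro h0
      rw [← List.length_append, List.length_eq_zero_iff] at h0
      rw [h0] at h
      have := h.eq_zero
      omega
    refine ⟨_, ⟨List.replicate u.length false, List.replicate v.length false, true,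
      by simp, rfl, ?_⟩,
      by simp, ?_⟩
    · have := h.col_false
      rwa [List.length_append, List.replicate_add] at this
    · have : u.length ≠ 0 ∨ v.length ≠ 0 := by omega
      simpa [List.mem_replicate] using this

/-- An arrangement of a single block is determined by its word. -/
theorem unique {Col' : List Bool → Prop} {e' : Op A A'} (h : Planar F w Col 1 e)
    (h' : Planar F w Col' 1 e') : e = e' := by
  have key {w : List Wire} {Col : List Bool → Prop} {e : Op A A'} (h : Planar F w Col 1 e) :
      ∃ x m, w = alt x (2 * m + 2) ∧ e = blk F x m := by
    generalize hn : 1 = n at h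
    cases h with
    | nil => omega
    | @ins u v _ n e x m h =>
      obtain rfl : n = 0 := by omega
      obtain ⟨h0, rfl⟩ := h.eq_nil
      obtain ⟨rfl, rfl⟩ := List.append_eq_nil_iff.1 h0
      exact ⟨x, m, by simp, by simp⟩
  obtain ⟨x, m, rfl, rfl⟩ := key h
  obtain ⟨x', m', hw, rfl⟩ := key h'
  obtain rfl : m = m' := by simpa using congrArg List.length hw
  obtain rfl : x = x' := by
    rw [alt_add_two, alt_add_two] at hw
    exact (List.cons.inj hw).1
  rfl

/-- Comultiplying a wire of an arrangement gives an arrangement with the same blocks. -/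
theorem fork (h : Planar F w Col n e) {u v : List Wire} {x : Wire} (hw : w = u ++ x :: v) :
    ∃ Col', Planar F (u ++ x :: x.dual :: x :: v) Col' n (e * sh u.length (Op.fork F)) ∧
      ∀ c, Col' c → ∃ cu b cv, cu.length = u.length ∧ c = cu ++ b :: b :: b :: cv ∧
        Col (cu ++ b :: cv) := by
  induction h generalizing u v with
  | nil => simp at hw
  | @ins u₀ v₀ Col n e y m h ih =>
    rcases append_eq_append_cons hw with ⟨a, rfl, rfl⟩ | ⟨p, q, hB, rfl, rfl⟩ | ⟨p, rfl, rfl⟩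
    · obtain ⟨Col', hP, hC⟩ := ih (u := u) (v := a ++ v₀) (by simp)
      have hP' : Planar F ((u ++ x :: x.dual :: x :: a) ++ v₀) Col' n
        (e * sh u.length (Op.fork F)) := hP.congr (by simp) rfl
      refine ⟨_, (hP'.ins y m).congr (by simp) ?_, ?_⟩
      · rw [mul_assoc, mul_assoc, fork_comm F (blk F y m) (k := (u ++ x :: a).length)] <;> simp
        omega
      · rintro c ⟨du, dv, b, hl, rfl, hc⟩
        obtain ⟨cu, b', cv, hcu, hd, hc'⟩ := hC _ hc
        simp only [List.length_append, List.length_cons] at hl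
        obtain ⟨t, rfl, rfl⟩ := exists_of_append_eq_append (c := cu ++ [b', b', b'])
          (d := cv) (by simpa using hd) (by simp; omega)
        refine ⟨cu, b', t ++ (List.replicate (2 * m + 2) b ++ dv), hcu, by simp,
          cu ++ b' :: t, dv, b, ?_, by simp, by simpa using hc'⟩
        simp at hl ⊢; omega
    · refine ⟨_, (h.ins y (m + 1)).congr ?_ ?_, ?_⟩
      · rw [show 2 * (m + 1) + 2 = 2 * m + 2 + 2 by ring, alt_insert hB]
        simp
      · have hl := congrArg List.length hB
        rw [length_alt, List.length_append, List.length_cons] at hl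
        rw [mul_assoc, List.length_append, ← sh_sh, ← map_mul, blk_fork F y (by omega)]
      · rintro c ⟨du, dv, b, hl, rfl, hc⟩
        have hl' := congrArg List.length hB
        rw [length_alt, List.length_append, List.length_cons] at hl'
        refine ⟨du ++ List.replicate p.length b, b, List.replicate q.length b ++ dv, by simp [hl],
          ?_, du, dv, b, hl, ?_, hc⟩
        · rw [show 2 * (m + 1) + 2 = p.length + (q.length + 3) by omega, List.replicate_add]
          simp [List.replicate_succ]
        · rw [show 2 * m + 2 = p.length + (q.length + 1) by omega, List.replicate_add]
          simp [List.replicate_succ]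
    · obtain ⟨Col', hP, hC⟩ := ih (u := u₀ ++ p) (v := v) (by simp)
      have hP' : Planar F (u₀ ++ (p ++ x :: x.dual :: x :: v)) Col' n
        (e * sh (u₀ ++ p).length (Op.fork F)) := hP.congr (by simp) rfl
      refine ⟨_, (hP'.ins y m).congr (by simp) ?_, ?_⟩
      · rw [mul_assoc, mul_assoc, blk_comm F y m (Op.fork F) (k := (u₀ ++ p).length)] <;> simp
        omega
      · rintro c ⟨du, dv, b, hl, rfl, hc⟩
        obtain ⟨cu, b', cv, hcu, hd, hc'⟩ := hC _ hc
        simp only [List.length_append] at hcu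
        obtain ⟨t, rfl, rfl⟩ := exists_of_append_eq_append hd.symm (by omega)
        refine ⟨du ++ (List.replicate (2 * m + 2) b ++ t), b', cv, ?_, by simp,
          du, t ++ b' :: cv, b, hl, by simp, by simpa using hc'⟩
        simp at hcu ⊢; omega

theorem forks (h : Planar F w Col n e) {u v : List Wire} {x : Wire} (hw : w = u ++ x :: v) (m : ℕ) :
    ∃ Col', Planar F (u ++ (alt x (2 * m + 1) ++ v)) Col' n (e * sh u.length (Op.fork F ^ m)) ∧
      ∀ c, Col' c → ∃ cu b cv, cu.length = u.length ∧
        c = cu ++ (List.replicate (2 * m + 1) b ++ cv) ∧ Col (cu ++ b :: cv) := by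
  induction m with
  | zero =>
    refine ⟨Col, h.congr (by simp [hw, alt]) (by simp), fun c hc => ?_⟩
    have hl := h.length_eq hc
    subst hw
    rw [← List.take_append_drop u.length c] at hc
    rw [List.length_append, List.length_cons] at hl
    rcases hd : c.drop u.length with _ | ⟨b, cv⟩
    · rw [List.drop_eq_nil_iff] at hd; omega
    · rw [hd] at hc
      refine ⟨c.take u.length, b, cv, by simp; omega, ?_, hc⟩
      exact (List.take_append_drop u.length c).symm.trans (by rw [hd]; simp)
  | succ m ih =>
    obtain ⟨Col₁, h₁, hC₁⟩ := ih
    have hl : alt x (2 * m + 1) = x :: alt x.dual (2 * m) := rfl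
    obtain ⟨Col₂, h₂, hC₂⟩ := h₁.fork (u := u) (x := x) (v := alt x.dual (2 * m) ++ v)
      (by rw [hl]; simp)
    refine ⟨Col₂, h₂.congr ?_ ?_, fun c hc => ?_⟩
    · rw [show 2 * (m + 1) + 1 = 2 * m + 1 + 2 by ring, alt_add_two, hl]; simp
    · rw [mul_assoc, ← map_mul, pow_succ]
    · obtain ⟨cu, b, cv, hu, rfl, hc₁⟩ := hC₂ c hc
      obtain ⟨cu', b', cv', hu', hd, hc₂⟩ := hC₁ _ hc₁
      obtain ⟨rfl, hd'⟩ := List.append_inj hd (hu.trans hu'.symm)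
      rw [List.replicate_succ, List.cons_append, List.cons.injEq] at hd'
      obtain ⟨rfl, rfl⟩ := hd'
      refine ⟨cu, b, cv', hu, ?_, hc₂⟩
      rw [show 2 * (m + 1) + 1 = 2 * m + 3 by ring]
      simp [List.replicate_succ]

/-- Capping off two adjacent wires of an arrangement closes up a block of length two, or else gives
an arrangement with one block less (if the wires belong to different blocks) or with the same number
of blocks (if they belong to the same block). In the last case the structure has to be normal. -/
theorem cap (h : Planar F w Col n e) {u v : List Wire} {x : Wire} (hw : w = u ++ x :: x.dual :: v) :
    Col (List.replicate u.length false ++ true :: true :: List.replicate v.length false) ∨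
      ∃ Col' n' d e', Planar F (u ++ v) Col' n' e' ∧ n' + 1 = n + d ∧
        (F.Normal ∨ d = 0 → e * sh u.length Op.cap = e') ∧
        ∀ c, Col' c →
          ∃ cu b cv, cu.length = u.length ∧ c = cu ++ cv ∧ Col (cu ++ b :: b :: cv) := by
  induction h generalizing u v with
  | nil => simp at hw
  | @ins u₀ v₀ Col n e y m h ih =>
    rcases append_eq_append_cons hw with ⟨a, rfl, ha⟩ | ⟨p, q, hB, rfl, hq⟩ | ⟨p, rfl, rfl⟩
    · rcases a with _ | ⟨z, a⟩
      · -- the first wire is just in front of the last block, the second is the first of the block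
        rw [alt_add_two, List.nil_append, List.cons_append, List.cons.injEq] at ha
        obtain ⟨rfl, rfl⟩ := ha
        obtain ⟨Col', hP, hC⟩ := h.forks (u := u) (x := x) (v := v₀) (by simp) m
        refine Or.inr ⟨Col', n, 0, _, hP.congr ?_ rfl, by omega, fun _ => ?_, fun c hc => ?_⟩
        · simp [alt]
        · have hgd := h.mul_gd (u := u) (x := x) (v := v₀) (by simp)
          rw [← hgd]
          have := congrArg (fun Q => e * sh u.length Q) (gd_blk_cap F x m)
          simpa [map_mul, sh_sh, mul_assoc] using this
        · obtain ⟨cu, b, cv, hu, rfl, hc'⟩ := hC c hc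
          refine ⟨cu, b, List.replicate (2 * m + 1) b ++ cv, hu, rfl, cu ++ [b], cv, b,
            by simp [hu], ?_, by simpa using hc'⟩
          simp [List.replicate_succ]
      · obtain ⟨rfl, rfl⟩ : x.dual = z ∧ v = a ++ (alt y (2 * m + 2) ++ v₀) := by simpa using ha
        rcases ih (u := u) (v := a ++ v₀) (by simp) with hc | ⟨Col', n', d, e', hP, hn, he, hC⟩
        · refine Or.inl ⟨List.replicate u.length false ++
              true :: true :: List.replicate a.length false,
            List.replicate v₀.length false, false, by simp, ?_, ?_⟩
          · simp only [List.length_append, length_alt, List.replicate_add, List.append_assoc,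
              List.cons_append]
          · simpa only [List.length_append, List.replicate_add, List.append_assoc,
              List.cons_append] using hc
        · have hP' : Planar F ((u ++ a) ++ v₀) Col' n' e' := hP.congr (by simp) rfl
          refine Or.inr ⟨_, n' + 1, d, _, (hP'.ins y m).congr (by simp) rfl, by omega,
            fun hd => ?_, ?_⟩
          · rw [← he hd, mul_assoc, mul_assoc, cap_comm (blk F y m) (j := (u ++ a).length)
              (k := (u ++ x :: x.dual :: a).length)] <;> simp
            omega
          · rintro c ⟨du, dv, b, hl, rfl, hc⟩
            obtain ⟨cu, b', cv, hcu, hd, hc'⟩ := hC _ hc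
            rw [List.length_append] at hl
            obtain ⟨t, rfl, rfl⟩ := exists_of_append_eq_append hd (by omega)
            refine ⟨cu, b', t ++ (List.replicate (2 * m + 2) b ++ dv), hcu, by simp,
              cu ++ b' :: b' :: t, dv, b, ?_, by simp, by simpa using hc'⟩
            simp at hl ⊢; omega
    · rcases q with _ | ⟨z, q⟩
      · -- the first wire is the last one of the last block, the second is the one behind the block
        rw [List.nil_append] at hq
        subst hq
        rw [alt_odd_append] at hB
        obtain ⟨rfl, hx⟩ := List.append_inj' hB rfl
        obtain rfl : y.dual = x := by simpa using hx
        rw [Wire.dual_dual] at h ih hw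
        obtain ⟨Col', hP, hC⟩ := h.forks (u := u₀) (x := y) (v := v) rfl m
        refine Or.inr ⟨Col', n, 0, _, hP.congr ?_ rfl, by omega, fun _ => ?_, fun c hc => ?_⟩
        · simp
        · have hgd := h.mul_gd (u := u₀) (x := y) (v := v) rfl
          rw [← hgd]
          have := congrArg (fun Q => e * sh u₀.length Q) (gd_blk_cap' F y m)
          simpa [map_mul, sh_sh, mul_assoc] using this
        · obtain ⟨cu, b, cv, hu, rfl, hc'⟩ := hC c hc
          refine ⟨cu ++ List.replicate (2 * m + 1) b, b, cv, by simp [hu], by simp, cu, b :: cv,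
            b, hu, ?_, hc'⟩
          rw [List.replicate_add (2 * m + 1) 1]
          simp
      · obtain ⟨rfl, rfl⟩ : x.dual = z ∧ v = q ++ v₀ := by simpa using hq
        have hl := congrArg List.length hB
        rw [length_alt, List.length_append, List.length_cons, List.length_cons] at hl
        cases m with
        | zero =>
          obtain ⟨rfl, rfl⟩ : p = [] ∧ q = [] := by
            constructor <;> rw [← List.length_eq_zero_iff] <;> omega
          refine Or.inl ⟨List.replicate u₀.length false, List.replicate v₀.length false, true,
            by simp, by simp [List.replicate_succ], ?_⟩
          have := h.col_false
          rwa [List.length_append, List.replicate_add] at this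
        | succ m =>
          refine Or.inr ⟨_, n + 1, 1, _, (h.ins y m).congr ?_ rfl, by omega, fun hd => ?_, ?_⟩
          · rw [show 2 * m + 2 = 2 * (m + 1) by ring, alt_remove hB]; simp
          · rw [mul_assoc, List.length_append, ← sh_sh, ← map_mul,
              blk_cap F (hd.resolve_right one_ne_zero) y (by omega)]
          · rintro c ⟨du, dv, b, hl', rfl, hc⟩
            refine ⟨du ++ List.replicate p.length b, b, List.replicate q.length b ++ dv,
              by simp [hl'], ?_, du, dv, b, hl', ?_, hc⟩
            · rw [show 2 * m + 2 = p.length + q.length by omega, List.replicate_add]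
              simp only [List.append_assoc]
            · rw [show 2 * (m + 1) + 2 = p.length + (q.length + 2) by omega, List.replicate_add]
              simp [List.replicate_succ]
    · rcases ih (u := u₀ ++ p) (v := v) (by simp) with hc | ⟨Col', n', d, e', hP, hn, he, hC⟩
      · refine Or.inl ⟨List.replicate u₀.length false,
          List.replicate p.length false ++ true :: true :: List.replicate v.length false, false,
          by simp, ?_, ?_⟩
        · simp only [List.length_append, length_alt, List.replicate_add, List.append_assoc]
        · simpa only [List.length_append, List.replicate_add, List.append_assoc] using hc
      · have hP' : Planar F (u₀ ++ (p ++ v)) Col' n' e' := hP.congr (by simp) rfl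
        refine Or.inr ⟨_, n' + 1, d, _, (hP'.ins y m).congr (by simp) rfl, by omega,
            fun hd => ?_, ?_⟩
        · rw [← he hd, mul_assoc, mul_assoc, blk_comm F y m Op.cap (k := (u₀ ++ p).length)] <;> simp
          omega
        · rintro c ⟨du, dv, b, hl, rfl, hc⟩
          obtain ⟨cu, b', cv, hcu, hd, hc'⟩ := hC _ hc
          rw [List.length_append] at hcu
          obtain ⟨t, rfl, rfl⟩ := exists_of_append_eq_append hd.symm (by omega)
          refine ⟨du ++ (List.replicate (2 * m + 2) b ++ t), b', cv, ?_, by simp,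
            du, t ++ b' :: b' :: cv, b, hl, by simp, by simpa using hc'⟩
          simp at hcu ⊢; omega

end Planar

end FrobeniusThree

namespace FrobeniusThree

open FrobeniusThreeStructure

/-! ### Colourings of diagrams -/

namespace Word

/-- The list of wires of a word. -/
def flat : Word → List Wire
  | FreeMonoidalCategory.of a => [a]
  | FreeMonoidalCategory.unit => []
  | FreeMonoidalCategory.tensor X Y => flat X ++ flat Y

theorem length_flat (X : Word) : X.flat.length = X.numWires := by
  induction X with
  | of a => rfl
  | unit => rfl
  | tensor X Y hX hY => rw [flat, List.length_append, hX, hY, numWires]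

/-- The colours of the wires of a word, in the order of the wires. -/
def listOf : (X : Word) → (Port X → Bool) → List Bool
  | FreeMonoidalCategory.of _, K => [K ()]
  | FreeMonoidalCategory.unit, _ => []
  | FreeMonoidalCategory.tensor X Y, K => listOf X (K ∘ Sum.inl) ++ listOf Y (K ∘ Sum.inr)

@[simp] theorem length_listOf (X : Word) (K : Port X → Bool) :
    (X.listOf K).length = X.flat.length := by
  induction X with
  | of a => rfl
  | unit => rfl
  | tensor X Y hX hY => rw [flat, listOf, List.length_append, List.length_append, hX, hY]

theorem listOf_const (X : Word) (b : Bool) :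
    (X.listOf fun _ => b) = List.replicate X.flat.length b := by
  induction X with
  | of a => rfl
  | unit => rfl
  | tensor X Y hX hY =>
    rw [flat, listOf, List.length_append, List.replicate_add, ← hX, ← hY]
    rfl

theorem listOf_injective (X : Word) : Function.Injective X.listOf := by
  induction X with
  | of a =>
    intro K K' h
    funext p
    exact (List.cons.inj h).1
  | unit => exact fun K K' _ => funext fun p => p.elim
  | tensor X Y hX hY =>
    intro K K' h
    obtain ⟨h₁, h₂⟩ := List.append_inj h (by rw [length_listOf, length_listOf])
    funext p
    rcases p with p | p
    · exact congrFun (hX h₁) p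
    · exact congrFun (hY h₂) p

theorem exists_listOf_eq (X : Word) {c : List Bool} (hc : c.length = X.flat.length) :
    ∃ K, X.listOf K = c := by
  induction X generalizing c with
  | of a =>
    obtain ⟨b, rfl⟩ := List.length_eq_one_iff.1 hc
    exact ⟨fun _ => b, rfl⟩
  | unit =>
    obtain rfl := List.length_eq_zero_iff.1 hc
    exact ⟨fun p => p.elim, rfl⟩
  | tensor X Y hX hY =>
    rw [flat, List.length_append] at hc
    obtain ⟨K, hK⟩ := hX (c := c.take (flat X).length) (by simp; omega)
    obtain ⟨L, hL⟩ := hY (c := c.drop (flat X).length) (by simp; omega)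
    refine ⟨Sum.elim K L, ?_⟩
    rw [← List.take_append_drop (flat X).length c, ← hK, ← hL]
    rfl

end Word

namespace PortGraph

variable {X Y Z W : Word}

/-- A colouring of the nodes of a graph that is constant on its components. -/
def IsColouring (G : PortGraph X Y) (K : G.Node → Bool) : Prop :=
  ∀ a b, G.graph.Adj a b → K a = K b

/-- The list of colours of the inputs. -/
def inCol (G : PortGraph X Y) (K : G.Node → Bool) : List Bool := X.listOf (K ∘ G.input)

/-- The list of colours of the outputs. -/
def outCol (G : PortGraph X Y) (K : G.Node → Bool) : List Bool := Y.listOf (K ∘ G.output)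

theorem IsColouring.eq {G : PortGraph X Y} {K : G.Node → Bool} (hK : G.IsColouring K)
    (hG : G.graph.Connected) (a b : G.Node) : K a = K b := by
  obtain ⟨p⟩ := hG.preconnected a b
  induction p with
  | nil => rfl
  | cons h _ ih => exact (hK _ _ h).trans ih

theorem IsColouring.const (G : PortGraph X Y) (b : Bool) : G.IsColouring fun _ => b :=
  fun _ _ _ => rfl

theorem isColouring_comp {G : PortGraph X Y} {H : PortGraph Y Z} {K : G.Node → Bool}
    {L : H.Node → Bool} (hK : G.IsColouring K) (hL : H.IsColouring L)
    (h : G.outCol K = H.inCol L) :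
    (G.comp H).IsColouring (Sum.elim K (Sum.elim (K ∘ G.output) L)) := by
  have h' := Word.listOf_injective Y h
  have hrel (a b : (G.comp H).Node) (hab : ∃ p : Word.Port Y, a = Sum.inr (Sum.inl p) ∧
      (b = Sum.inl (G.output p) ∨ b = Sum.inr (Sum.inr (H.input p)))) :
      Sum.elim K (Sum.elim (K ∘ G.output) L) a = Sum.elim K (Sum.elim (K ∘ G.output) L) b := by
    obtain ⟨p, rfl, rfl | rfl⟩ := hab
    · rfl
    · exact congrFun h' p
  rintro a b (hab | ⟨-, hab | hab⟩)
  · rcases a with a | a | a <;> rcases b with b | b | b <;> simp at hab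
    · exact hK _ _ hab
    · exact hL _ _ hab
  · exact hrel a b hab
  · exact (hrel b a hab).symm

theorem isColouring_tensor {G : PortGraph X Y} {H : PortGraph Z W} {K : G.Node → Bool}
    {L : H.Node → Bool} (hK : G.IsColouring K) (hL : H.IsColouring L) :
    (G.tensor H).IsColouring (Sum.elim K L) := by
  rintro (a | a) (b | b) hab <;> simp [PortGraph.tensor] at hab
  · exact hK _ _ hab
  · exact hL _ _ hab

end PortGraph

/-! ### Diagrams acting on planar arrangements -/

section Transform

variable {C : Type u} [Category.{v} C] [MonoidalCategory C] {A A' : C}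
variable [ExactPairing A' A] [ExactPairing A A'] (F : FrobeniusThreeStructure A A')

open Op

/-- The effect of an operator `O`, which is thought of as a diagram with graph `G` and Euler
characteristic `χ`, on a planar arrangement that contains its inputs. Either a component is closed
up, which is expressed by a colouring that is `true` on this component and `false` on all wires that
remain; or the result is again a planar arrangement. In the second case every colouring of the
result extends to `G` and the original arrangement. The defect `d` counts how often two wires of the
same component are joined; it is determined by the numbers of blocks and `χ`. Unless it vanishes,
equality holds in normal structures only. -/
def Transforms {X Y : Word} (G : PortGraph X Y) (O : Op A A') (χ : ℤ) : Prop :=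
  ∀ {U V : List Wire} {Col : List Bool → Prop} {n : ℕ} {e : Op A A'},
    Planar F (U ++ (X.flat ++ V)) Col n e →
    (∃ K, G.IsColouring K ∧ (∃ a, K a = true) ∧ (∀ p, K (G.output p) = false) ∧
      Col (List.replicate U.length false ++ (G.inCol K ++ List.replicate V.length false))) ∨
    ∃ Col' n' d e', Planar F (U ++ (Y.flat ++ V)) Col' n' e' ∧
      (n' : ℤ) = n + χ - X.flat.length + (d : ℕ) ∧
      (F.Normal ∨ d = 0 → e * sh U.length O = e') ∧
      ∀ c, Col' c → ∃ cu K cv, cu.length = U.length ∧ c = cu ++ (G.outCol K ++ cv) ∧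
        Col (cu ++ (G.inCol K ++ cv)) ∧ G.IsColouring K

namespace Transforms

variable {F} {X Y Z W : Word}

theorem wires (p : Word.Port X ≃ Word.Port Y) (h : X.flat = Y.flat)
    (hl : ∀ K, X.listOf (K ∘ p) = Y.listOf K) :
    Transforms F (PortGraph.wires p) 1 Y.flat.length := by
  intro U V Col n e he
  refine Or.inr ⟨Col, n, 0, e, h ▸ he, by rw [h]; simp, by simp, fun c hc => ?_⟩
  have hlen := he.length_eq hc
  simp only [List.length_append] at hlen
  obtain ⟨K, hK⟩ := Y.exists_listOf_eq (c := (c.drop U.length).take Y.flat.length)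
    (by rw [h] at hlen; simp; omega)
  have hc' : c = c.take U.length ++ (Y.listOf K ++ (c.drop U.length).drop Y.flat.length) := by
    rw [hK, List.take_append_drop, List.take_append_drop]
  refine ⟨c.take U.length, K, (c.drop U.length).drop Y.flat.length, by simp; omega, hc', ?_,
    fun _ _ h => h.elim⟩
  rw [hc'] at hc
  have h₁ : (PortGraph.wires p).inCol K = Y.listOf K := hl K
  rw [h₁]
  exact hc

theorem comp {G : PortGraph X Y} {H : PortGraph Y Z} {O P : Op A A'} {χ ψ : ℤ}
    (hG : Transforms F G O χ) (hH : Transforms F H P ψ) :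
    Transforms F (G.comp H) (O * P) (χ + ψ - Y.flat.length) := by
  intro U V Col n e he
  rcases hG he with ⟨K, hK, ⟨a, ha⟩, hout, hc⟩ | ⟨Col₁, n₁, d₁, e₁, h₁, hn₁, he₁, hC₁⟩
  · have hin : G.outCol K = H.inCol fun _ => false :=
      congrArg Y.listOf (funext hout)
    exact Or.inl ⟨_, PortGraph.isColouring_comp hK (PortGraph.IsColouring.const H false) hin,
      ⟨Sum.inl a, ha⟩, fun _ => rfl, hc⟩
  rcases hH h₁ with ⟨L, hL, ⟨a, ha⟩, hout, hc⟩ | ⟨Col₂, n₂, d₂, e₂, h₂, hn₂, he₂, hC₂⟩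
  · obtain ⟨cu, K, cv, hu, hcc, hc', hK⟩ := hC₁ _ hc
    obtain ⟨rfl, h'⟩ := List.append_inj hcc (by simp [hu])
    obtain ⟨h'', rfl⟩ := List.append_inj h' (by simp [PortGraph.inCol, PortGraph.outCol])
    exact Or.inl ⟨_, PortGraph.isColouring_comp hK hL h''.symm, ⟨Sum.inr (Sum.inr a), ha⟩, hout,
      hc'⟩
  · refine Or.inr ⟨Col₂, n₂, d₁ + d₂, e₂, h₂, by push_cast; omega, fun hd => ?_, fun c hc => ?_⟩
    · rw [map_mul, ← mul_assoc, he₁ (hd.imp_right (by omega)), he₂ (hd.imp_right (by omega))]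
    · obtain ⟨cu, L, cv, hu, rfl, hc₁, hL⟩ := hC₂ c hc
      obtain ⟨cu', K, cv', hu', hcc, hc', hK⟩ := hC₁ _ hc₁
      obtain ⟨rfl, h'⟩ := List.append_inj hcc (by simp [hu, hu'])
      obtain ⟨h'', rfl⟩ := List.append_inj h' (by simp [PortGraph.inCol, PortGraph.outCol])
      exact ⟨cu, Sum.elim K (Sum.elim (K ∘ G.output) L), cv, hu, rfl, hc',
        PortGraph.isColouring_comp hK hL h''.symm⟩

theorem tensor {G : PortGraph X Y} {H : PortGraph Z W} {O P : Op A A'} {χ ψ : ℤ}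
    (hG : Transforms F G O χ) (hH : Transforms F H P ψ) :
    Transforms F (G.tensor H) (O * sh Y.flat.length P) (χ + ψ) := by
  have hin (K : G.Node → Bool) (L : H.Node → Bool) :
      (G.tensor H).inCol (Sum.elim K L) = G.inCol K ++ H.inCol L := rfl
  have hout (K : G.Node → Bool) (L : H.Node → Bool) :
      (G.tensor H).outCol (Sum.elim K L) = G.outCol K ++ H.outCol L := rfl
  intro U V Col n e he
  rw [Word.flat, List.append_assoc] at he
  rcases hG he with ⟨K, hK, ⟨a, ha⟩, hO, hc⟩ | ⟨Col₁, n₁, d₁, e₁, h₁, hn₁, he₁, hC₁⟩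
  · refine Or.inl ⟨_, PortGraph.isColouring_tensor hK (PortGraph.IsColouring.const H false),
      ⟨Sum.inl a, ha⟩, ?_, ?_⟩
    · rintro (p | p)
      · exact hO p
      · rfl
    · have h : (H.inCol fun _ => false) = List.replicate Z.flat.length false := Z.listOf_const false
      rw [hin, h, List.append_assoc, ← List.replicate_add, ← List.length_append]
      exact hc
  have h₁' : Planar F ((U ++ Y.flat) ++ (Z.flat ++ V)) Col₁ n₁ e₁ := h₁.congr (by simp) rfl
  rcases hH h₁' with ⟨L, hL, ⟨a, ha⟩, hO, hc⟩ | ⟨Col₂, n₂, d₂, e₂, h₂, hn₂, he₂, hC₂⟩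
  · obtain ⟨cu, K, cv, hu, hcc, hc', hK⟩ := hC₁ _ hc
    rw [List.length_append, List.replicate_add, List.append_assoc] at hcc
    obtain ⟨rfl, h'⟩ := List.append_inj hcc (by simp [hu])
    obtain ⟨h'', rfl⟩ := List.append_inj h' (by simp [PortGraph.outCol])
    refine Or.inl ⟨_, PortGraph.isColouring_tensor hK hL, ⟨Sum.inr a, ha⟩, ?_, ?_⟩
    · rintro (p | p)
      · have h : (Y.listOf fun _ => false) = G.outCol K := (Y.listOf_const false).trans h''
        exact (congrFun (Word.listOf_injective Y h) p).symm
      · exact hO p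
    · rw [hin, List.append_assoc]
      exact hc'
  · refine Or.inr ⟨Col₂, n₂, d₁ + d₂, e₂, h₂.congr (by simp [Word.flat]) rfl, ?_, fun hd => ?_,
      fun c hc => ?_⟩
    · rw [Word.flat, List.length_append]; push_cast; omega
    · rw [map_mul, ← mul_assoc, he₁ (hd.imp_right (by omega)), sh_sh, ← List.length_append,
        he₂ (hd.imp_right (by omega))]
    · obtain ⟨cu, L, cv, hu, rfl, hc₁, hL⟩ := hC₂ c hc
      obtain ⟨cu', K, cv', hu', hcc, hc', hK⟩ := hC₁ _ hc₁
      rw [List.length_append] at hu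
      obtain ⟨t, rfl, ht⟩ := exists_of_append_eq_append hcc (by omega)
      rw [List.length_append] at hu
      obtain ⟨rfl, rfl⟩ := List.append_inj ht (by simp [PortGraph.outCol]; omega)
      exact ⟨cu', Sum.elim K L, cv, hu', by rw [hout]; simp, by rw [hin]; simpa using hc',
        PortGraph.isColouring_tensor hK hL⟩

theorem inCol_dot (b : Bool) :
    (PortGraph.dot X Y).inCol (fun _ => b) = List.replicate X.flat.length b :=
  X.listOf_const b

theorem outCol_dot (b : Bool) :
    (PortGraph.dot X Y).outCol (fun _ => b) = List.replicate Y.flat.length b :=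
  Y.listOf_const b

theorem cup (x : Wire) (hX : X.flat = [x, x.dual]) :
    Transforms F (PortGraph.dot Word.one X) (Op.cup x) 1 := by
  intro U V Col n e he
  refine Or.inr ⟨_, n + 1, 0, _, (Planar.ins x 0 (u := U) (v := V) he).congr (by rw [hX]; rfl) rfl,
    by simp [Word.flat], fun _ => by simp [blk], fun c hc => ?_⟩
  obtain ⟨cu, cv, b, hu, rfl, hc⟩ := hc
  refine ⟨cu, fun _ => b, cv, hu, ?_, ?_, PortGraph.IsColouring.const _ b⟩
  · rw [outCol_dot, hX]; rfl
  · rw [inCol_dot]; exact hc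

theorem cap (x : Wire) (hX : X.flat = [x, x.dual]) :
    Transforms F (PortGraph.dot X Word.one) Op.cap 1 := by
  intro U V Col n e he
  rw [hX] at he
  rcases he.cap (u := U) (x := x) (v := V) rfl with hc | ⟨Col', n', d, e', h', hn, he', hC⟩
  · refine Or.inl ⟨fun _ => true, PortGraph.IsColouring.const _ true, ⟨(), rfl⟩, fun p => p.elim,
      ?_⟩
    rw [inCol_dot, hX]
    exact hc
  · refine Or.inr ⟨Col', n', d, e', h', ?_, he', fun c hc => ?_⟩
    · rw [hX]; simp; omega
    · obtain ⟨cu, b, cv, hu, rfl, hc'⟩ := hC c hc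
      refine ⟨cu, fun _ => b, cv, hu, rfl, ?_, PortGraph.IsColouring.const _ b⟩
      rw [inCol_dot, hX]
      exact hc'

theorem comul : Transforms F (PortGraph.dot Word.up Word.three) (Op.comul F) 1 := by
  intro U V Col n e he
  obtain ⟨Col', h', hC⟩ := he.fork (u := U) (x := Wire.up) (v := V) rfl
  refine Or.inr ⟨Col', n, 0, _, h', by simp [Word.flat], fun _ => ?_, fun c hc => ?_⟩
  · have hgd := he.mul_gd (u := U) (x := Wire.up) (v := V) rfl
    rw [← hgd, mul_assoc, mul_assoc, ← map_mul, ← map_mul, gd_fork_up]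
  · obtain ⟨cu, b, cv, hu, rfl, hc'⟩ := hC c hc
    exact ⟨cu, fun _ => b, cv, hu, rfl, hc', PortGraph.IsColouring.const _ b⟩

/-- The multiplication is the comultiplication of its first input, followed by two caps. These caps
join different components to that of the first input, or increase the defect; they cannot close up a
component because a wire of the comultiplication remains. -/
theorem mul : Transforms F (PortGraph.dot Word.three Word.up) (Op.mul F) 1 := by
  intro U V Col n e he
  have key {cu cu' cv cv' : List Bool} {b b' : Bool} (hu : cu.length = U.length)
      (hu' : cu'.length = (U ++ [Wire.up, Wire.down]).length)
      (h : cu' ++ b' :: b' :: cv' = cu ++ b :: b :: b :: cv) :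
      cu' = cu ++ [b, b] ∧ b' = b ∧ cv = b :: cv' := by
    rw [show cu ++ b :: b :: b :: cv = (cu ++ [b, b]) ++ b :: cv by simp] at h
    obtain ⟨rfl, h'⟩ := List.append_inj h (by simp [hu, hu'])
    simp only [List.cons.injEq] at h'
    obtain ⟨rfl, rfl⟩ := h'
    exact ⟨rfl, rfl, rfl⟩
  obtain ⟨Col₁, h₁, hC₁⟩ := he.fork (u := U) (x := Wire.up) (v := Wire.down :: Wire.up :: V) rfl
  rcases h₁.cap (u := U ++ [Wire.up, Wire.down]) (x := Wire.up) (v := Wire.up :: V)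
      (by simp [Wire.dual]) with hc | ⟨Col₂, n₂, d₂, e₂, h₂, hn₂, he₂, hC₂⟩
  · obtain ⟨cu, b, cv, hu, hcc, -⟩ := hC₁ _ hc
    rw [List.length_append, List.replicate_add, List.append_assoc] at hcc
    obtain ⟨-, h⟩ := List.append_inj hcc (by simp [hu])
    simp [List.replicate_succ] at h
    obtain ⟨rfl, h, -⟩ := h
    exact absurd h (by decide)
  rcases h₂.cap (u := U ++ [Wire.up]) (x := Wire.down) (v := V) (by simp [Wire.dual])
    with hc | ⟨Col₃, n₃, d₃, e₃, h₃, hn₃, he₃, hC₃⟩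
  · obtain ⟨cu', b', cv', hu', hcc', hc'⟩ := hC₂ _ hc
    obtain ⟨cu, b, cv, hu, hcc, -⟩ := hC₁ _ hc'
    obtain ⟨rfl, rfl, rfl⟩ := key hu hu' hcc
    rw [List.length_append, List.replicate_add, List.append_assoc, List.append_assoc] at hcc'
    obtain ⟨-, h⟩ := List.append_inj hcc' (by simp [hu])
    simp at h
    obtain ⟨rfl, h, -⟩ := h
    exact absurd h (by decide)
  refine Or.inr ⟨Col₃, n₃, d₂ + d₃, e₃, h₃.congr (by simp; rfl) rfl, ?_, fun hd => ?_,
    fun c hc => ?_⟩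
  · simp [Word.flat]; omega
  · have hg₂ := he.mul_gd (u := U ++ [Wire.up, Wire.down]) (x := Wire.up) (v := V)
      (by simp [Word.flat])
    have hg₁ := he.mul_gd (u := U ++ [Wire.up]) (x := Wire.down) (v := Wire.up :: V)
      (by simp [Word.flat])
    have hg₀ := he.mul_gd (u := U) (x := Wire.up) (v := Wire.down :: Wire.up :: V)
      (by simp [Word.flat])
    have h := congrArg (fun Q => e * sh U.length Q) (mul_eq_fork F)
    rw [List.length_append] at hg₁ hg₂ he₂ he₃
    simp only [List.length_cons, List.length_nil, Nat.zero_add, Nat.reduceAdd] at hg₁ hg₂ he₂ he₃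
    simp only [map_mul, sh_sh, ← mul_assoc, hg₂, hg₁, hg₀] at h
    rw [← h, he₂ (hd.imp_right (by omega)), he₃ (hd.imp_right (by omega))]
  · obtain ⟨cu₃, b₃, cv₃, hu₃, rfl, hc₂⟩ := hC₃ _ hc
    obtain ⟨cu₂, b₂, cv₂, hu₂, hcc, hc₁⟩ := hC₂ _ hc₂
    obtain ⟨cu, b, cv, hu, hcc', hc'⟩ := hC₁ _ hc₁
    obtain ⟨rfl, rfl, rfl⟩ := key hu hu₂ hcc'
    rw [show cu ++ [b₂, b₂] ++ cv₂ = (cu ++ [b₂]) ++ b₂ :: cv₂ by simp] at hcc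
    obtain ⟨rfl, h⟩ := List.append_inj hcc (by simp [hu, hu₃])
    simp only [List.cons.injEq] at h
    obtain ⟨rfl, rfl⟩ := h
    exact ⟨cu, fun _ => b₃, cv₃, hu, by simp [outCol_dot, Word.flat], hc',
      PortGraph.IsColouring.const _ b₃⟩

end Transforms

end Transform

namespace Diagram

/-- The Euler characteristic of the underlying graph of a diagram: the number of nodes minus the
number of edges. -/
def chi : {X Y : Word} → Diagram X Y → ℤ
  | _, _, mul => 1
  | _, _, comul => 1
  | _, _, cup => 1
  | _, _, cupSwap => 1
  | _, _, cap => 1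
  | _, _, capSwap => 1
  | _, _, @comp _ Y _ D E => D.chi + E.chi - Y.flat.length
  | _, _, tensor D E => D.chi + E.chi
  | _, Y, _ => Y.flat.length

variable {C : Type u} [Category.{v} C] [MonoidalCategory C] {A A' : C}
variable [ExactPairing A' A] [ExactPairing A A'] (F : FrobeniusThreeStructure A A')

/-- The operator that applies a diagram to the wires at the head of a word. -/
def toOp : {X Y : Word} → Diagram X Y → Op A A'
  | _, _, mul => Op.mul F
  | _, _, comul => Op.comul F
  | _, _, cup => Op.cup Wire.down
  | _, _, cupSwap => Op.cup Wire.up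
  | _, _, cap => Op.cap
  | _, _, capSwap => Op.cap
  | _, _, comp D E => D.toOp * E.toOp
  | _, _, @tensor _ Y _ _ D E => D.toOp * Op.sh Y.flat.length E.toOp
  | _, _, _ => 1

theorem transforms {X Y : Word} (D : Diagram X Y) : Transforms F D.toGraph (D.toOp F) D.chi := by
  induction D with
  | mul => exact Transforms.mul
  | comul => exact Transforms.comul
  | cup => exact Transforms.cup _ rfl
  | cupSwap => exact Transforms.cup _ rfl
  | cap => exact Transforms.cap Wire.up rfl
  | capSwap => exact Transforms.cap Wire.down rfl
  | id X => exact Transforms.wires _ rfl fun K => rfl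
  | assocHom X Y Z => exact Transforms.wires _ (List.append_assoc _ _ _) fun K =>
      List.append_assoc _ _ _
  | assocInv X Y Z => exact Transforms.wires _ (List.append_assoc _ _ _).symm fun K =>
      (List.append_assoc _ _ _).symm
  | leftUnitorHom X =>
    exact Transforms.wires (X := Word.one.tensor X) (Y := X)
      (Equiv.emptySum Empty (Word.Port X)) rfl fun K => rfl
  | leftUnitorInv X =>
    exact Transforms.wires (X := X) (Y := Word.one.tensor X)
      (Equiv.emptySum Empty (Word.Port X)).symm rfl fun K => rfl
  | rightUnitorHom X => exact Transforms.wires _ (List.append_nil _) fun K => List.append_nil _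
  | rightUnitorInv X => exact Transforms.wires _ (List.append_nil _).symm fun K =>
      (List.append_nil _).symm
  | comp D E hD hE => exact hD.comp hE
  | tensor D E hD hE => exact hD.tensor hE

end Diagram

end FrobeniusThree

namespace FrobeniusThree

open FrobeniusThreeStructure

/-! ### Counting nodes and edges -/

namespace Word

/-- The wires of a word form a finite type. -/
instance fintypePort : (X : Word) → Fintype (Port X)
  | FreeMonoidalCategory.of _ => inferInstanceAs (Fintype Unit)
  | FreeMonoidalCategory.unit => inferInstanceAs (Fintype Empty)
  | FreeMonoidalCategory.tensor X Y =>
    let _ := fintypePort X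
    let _ := fintypePort Y
    inferInstanceAs (Fintype (Port X ⊕ Port Y))

theorem card_port (X : Word) : Fintype.card (Port X) = X.flat.length := by
  induction X with
  | of a => rfl
  | unit => rfl
  | tensor X Y hX hY =>
    rw [flat, List.length_append, ← hX, ← hY]
    exact Fintype.card_sum

end Word

namespace PortGraph

open Classical in
/-- A graph has finitely many nodes, and `χ` is the number of its nodes minus the number of its
edges. The edges are counted twice, as ordered pairs of adjacent nodes. -/
def HasEuler {X Y : Word} (G : PortGraph X Y) (χ : ℤ) : Prop :=
  ∃ _ : Fintype G.Node,
    ∑ a, ∑ b, (if G.graph.Adj a b then (1 : ℤ) else 0) = 2 * (Fintype.card G.Node - χ)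

variable {X Y Z W : Word}

theorem hasEuler_dot : (dot X Y).HasEuler 1 := by
  let : Fintype (dot X Y).Node := (inferInstance : Fintype Unit)
  refine ⟨this, ?_⟩
  rw [show Fintype.card (dot X Y).Node = 1 from rfl]
  simp [dot]

theorem hasEuler_wires (e : Word.Port X ≃ Word.Port Y) : (wires e).HasEuler Y.flat.length := by
  let : Fintype (wires e).Node := (inferInstance : Fintype (Word.Port Y))
  refine ⟨this, ?_⟩
  rw [show Fintype.card (wires e).Node = Y.flat.length from Y.card_port]
  simp [wires]

theorem HasEuler.tensor {G : PortGraph X Y} {H : PortGraph Z W} {χ ψ : ℤ} (hG : G.HasEuler χ)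
    (hH : H.HasEuler ψ) : (G.tensor H).HasEuler (χ + ψ) := by
  classical
  obtain ⟨_, hG⟩ := hG
  obtain ⟨_, hH⟩ := hH
  let : Fintype (G.tensor H).Node := (inferInstance : Fintype (G.Node ⊕ H.Node))
  refine ⟨this, ?_⟩
  rw [show Fintype.card (G.tensor H).Node = _ from Fintype.card_sum]
  refine (Fintype.sum_sum_type _).trans ?_
  have h₁ (a : G.Node) : ∑ b : (G.tensor H).Node,
      (if (G.tensor H).graph.Adj (Sum.inl a) b then (1 : ℤ) else 0) =
        ∑ b, if G.graph.Adj a b then 1 else 0 := by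
    refine (Fintype.sum_sum_type _).trans ?_
    simp [PortGraph.tensor]
  have h₂ (a : H.Node) : ∑ b : (G.tensor H).Node,
      (if (G.tensor H).graph.Adj (Sum.inr a) b then (1 : ℤ) else 0) =
        ∑ b, if H.graph.Adj a b then 1 else 0 := by
    refine (Fintype.sum_sum_type _).trans ?_
    simp [PortGraph.tensor]
  simp only [h₁]
  refine (congrArg _ (Finset.sum_congr rfl fun a _ => h₂ a)).trans ?_
  rw [hG, hH]
  push_cast
  ring

theorem HasEuler.comp {G : PortGraph X Y} {H : PortGraph Y Z} {χ ψ : ℤ} (hG : G.HasEuler χ)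
    (hH : H.HasEuler ψ) : (G.comp H).HasEuler (χ + ψ - Y.flat.length) := by
  classical
  obtain ⟨_, hG⟩ := hG
  obtain ⟨_, hH⟩ := hH
  let : Fintype (G.comp H).Node := (inferInstance : Fintype (G.Node ⊕ (Word.Port Y ⊕ H.Node)))
  refine ⟨this, ?_⟩
  have hcard : Fintype.card (G.comp H).Node =
      Fintype.card G.Node + (Y.flat.length + Fintype.card H.Node) := by
    rw [← Y.card_port, ← Fintype.card_sum, ← Fintype.card_sum]
    rfl
  rw [hcard]
  refine (Fintype.sum_sum_type _).trans ?_
  have h₁ (a : G.Node) : ∑ b : (G.comp H).Node,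
      (if (G.comp H).graph.Adj (Sum.inl a) b then (1 : ℤ) else 0) =
        (∑ b, if G.graph.Adj a b then 1 else 0) + ∑ p, if a = G.output p then 1 else 0 := by
    refine (Fintype.sum_sum_type _).trans ?_
    congr 1
    · simp [PortGraph.comp]
    · refine (Fintype.sum_sum_type _).trans ?_
      simp [PortGraph.comp]
  have h₂ (p : Word.Port Y) : ∑ b : (G.comp H).Node,
      (if (G.comp H).graph.Adj (Sum.inr (Sum.inl p)) b then (1 : ℤ) else 0) = 2 := by
    refine (Fintype.sum_sum_type _).trans ?_
    rw [show (2 : ℤ) = 1 + 1 by rfl]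
    congr 1
    · simp [PortGraph.comp]
    · refine (Fintype.sum_sum_type _).trans ?_
      simp [PortGraph.comp]
  have h₃ (a : H.Node) : ∑ b : (G.comp H).Node,
      (if (G.comp H).graph.Adj (Sum.inr (Sum.inr a)) b then (1 : ℤ) else 0) =
        (∑ p, if a = H.input p then 1 else 0) + ∑ b, if H.graph.Adj a b then 1 else 0 := by
    refine (Fintype.sum_sum_type _).trans ?_
    rw [← zero_add ((∑ p, if a = H.input p then (1 : ℤ) else 0) + _)]
    congr 1
    · simp [PortGraph.comp]
    · refine (Fintype.sum_sum_type _).trans ?_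
      simp [PortGraph.comp]
  have h₄ : ∑ a : G.Node, ∑ p, (if a = G.output p then (1 : ℤ) else 0) = Y.flat.length := by
    rw [Finset.sum_comm]
    simp [Y.card_port]
  have h₅ : ∑ a : H.Node, ∑ p, (if a = H.input p then (1 : ℤ) else 0) = Y.flat.length := by
    rw [Finset.sum_comm]
    simp [Y.card_port]
  simp only [h₁]
  rw [Finset.sum_add_distrib, h₄, hG]
  refine (congrArg _ (Fintype.sum_sum_type _)).trans ?_
  simp only [h₂, h₃]
  rw [Finset.sum_add_distrib, h₅, hH, Finset.sum_const, Finset.card_univ, Y.card_port]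
  push_cast
  ring

/-- The Euler characteristic of a tree is one. -/
theorem HasEuler.eq_one {G : PortGraph X Y} {χ : ℤ} (h : G.HasEuler χ) (hG : G.graph.IsTree) :
    χ = 1 := by
  classical
  obtain ⟨_, h⟩ := h
  have h₁ := hG.card_edgeFinset
  have h₂ := G.graph.sum_degrees_eq_twice_card_edges
  have h₃ (a : G.Node) : ∑ b, (if G.graph.Adj a b then (1 : ℤ) else 0) = G.graph.degree a := by
    rw [Finset.sum_boole, ← G.graph.card_neighborFinset_eq_degree, G.graph.neighborFinset_eq_filter]
  simp only [h₃] at h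
  rw [← Nat.cast_sum, h₂, ← h₁] at h
  push_cast at h
  linarith

end PortGraph

namespace Diagram

theorem hasEuler {X Y : Word} (D : Diagram X Y) : D.toGraph.HasEuler D.chi := by
  induction D with
  | comp D E hD hE => exact hD.comp hE
  | tensor D E hD hE => exact hD.tensor hE
  | mul | comul | cup | cupSwap | cap | capSwap => exact PortGraph.hasEuler_dot
  | _ => exact PortGraph.hasEuler_wires _

/-- Because every piece has at least two wires, a diagram whose graph is a tree has outer wires. -/
theorem two_mul_chi_le {X Y : Word} (D : Diagram X Y) :
    2 * D.chi ≤ X.flat.length + Y.flat.length := by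
  induction D with
  | comp D E hD hE => rw [chi]; linarith
  | tensor D E hD hE =>
    rw [chi, Word.flat, Word.flat, List.length_append,
      List.length_append]
    push_cast
    linarith
  | _ => simp [chi, Word.flat] <;> omega

end Diagram

end FrobeniusThree

namespace FrobeniusThree

open FrobeniusThreeStructure

/-! ### Operators represent the values of diagrams -/

namespace Word

/-- The list of wires of a word, put in front of another list. This is `X.flat ++ w`, but is
defined by recursion so that reassociating `X` does not change it, even definitionally. -/
def onto : Word → List Wire → List Wire
  | FreeMonoidalCategory.of a, w => a :: w
  | FreeMonoidalCategory.unit, w => w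
  | FreeMonoidalCategory.tensor X Y, w => onto X (onto Y w)

theorem onto_eq (X : Word) (w : List Wire) : X.onto w = X.flat ++ w := by
  induction X generalizing w with
  | of a => rfl
  | unit => rfl
  | tensor X Y hX hY => rw [onto, hX, hY, flat, List.append_assoc]

variable {C : Type u} [Category.{v} C] [MonoidalCategory C]

/-- The coherence isomorphism that removes the brackets of a word in front of a list of wires. -/
def ontoIso (A A' : C) : (X : Word) → (w : List Wire) →
    (wordObj A A' X ⊗ listObj A A' w ≅ listObj A A' (X.onto w))
  | FreeMonoidalCategory.of _, _ => Iso.refl _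
  | FreeMonoidalCategory.unit, _ => λ_ _
  | FreeMonoidalCategory.tensor X Y, w =>
    α_ _ _ _ ≪≫ whiskerLeftIso (wordObj A A' X) (ontoIso A A' Y w) ≪≫ ontoIso A A' X (onto Y w)

variable {A A' : C}

/-- Shifting an operator by a word corresponds to whiskering by its object. -/
theorem exists_sh_app {P : Op A A'} {w w' : List Wire} {f : listObj A A' w ⟶ listObj A A' w'}
    (h : P.app w = some ⟨w', f⟩) (X : Word) :
    ∃ g, (Op.sh X.flat.length P).app (X.onto w) = some ⟨X.onto w', g⟩ ∧
      (ontoIso A A' X w).hom ≫ g = wordObj A A' X ◁ f ≫ (ontoIso A A' X w').hom := by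
  induction X generalizing P w w' with
  | of a =>
    refine ⟨wireObj A A' a ◁ f, ?_, ?_⟩
    · simp [flat, onto, Op.sh, h]
    · exact (Category.id_comp _).trans (Category.comp_id _).symm
  | unit => exact ⟨f, h, (leftUnitor_naturality f).symm⟩
  | tensor X Y hX hY =>
    obtain ⟨g, hg, hg'⟩ := hY h
    obtain ⟨k, hk, hk'⟩ := hX hg
    refine ⟨k, ?_, ?_⟩
    · rw [flat, List.length_append, ← Op.sh_sh]
      exact hk
    · change ((α_ _ _ _).hom ≫ _ ◁ (ontoIso A A' Y w).hom ≫ (ontoIso A A' X _).hom) ≫ k =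
        (wordObj A A' X ⊗ wordObj A A' Y) ◁ f ≫
          (α_ _ _ _).hom ≫ _ ◁ (ontoIso A A' Y w').hom ≫ (ontoIso A A' X _).hom
      rw [Category.assoc, Category.assoc, hk', ← whiskerLeft_comp_assoc, hg',
        associator_naturality_right_assoc, whiskerLeft_comp_assoc]

end Word

namespace Diagram

open Word

variable {C : Type u} [Category.{v} C] [MonoidalCategory C] {A A' : C}
variable [ExactPairing A' A] [ExactPairing A A'] (F : FrobeniusThreeStructure A A')

/-- The operator of a diagram computes its value, up to the coherence isomorphisms. -/
theorem exists_toOp_app {X Y : Word} (D : Diagram X Y) (w : List Wire) :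
    ∃ g, (D.toOp F).app (X.onto w) = some ⟨Y.onto w, g⟩ ∧
      (ontoIso A A' X w).hom ≫ g = F.eval D ▷ listObj A A' w ≫ (ontoIso A A' Y w).hom := by
  induction D generalizing w with
  | mul =>
    refine ⟨_, rfl, ?_⟩
    change ((α_ _ _ _).hom ≫ A ◁ ((α_ _ _ _).hom ≫ A' ◁ 𝟙 _ ≫ 𝟙 _) ≫ 𝟙 _) ≫
      Op.mulAt F (listObj A A' w) = F.mul ▷ listObj A A' w ≫ 𝟙 _
    simp [Op.mulAt]
  | comul =>
    refine ⟨_, rfl, ?_⟩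
    change 𝟙 _ ≫ A ◁ Op.cupAt A' A (listObj A A' w) ≫
        A ◁ A' ◁ Op.cupAt A A' (A ⊗ listObj A A' w) ≫ Op.mulAt F (A' ⊗ A ⊗ listObj A A' w) =
      F.comul ▷ listObj A A' w ≫ (α_ _ _ _).hom ≫ A ◁ ((α_ _ _ _).hom ≫ A' ◁ 𝟙 _ ≫ 𝟙 _) ≫ 𝟙 _
    simp only [Op.mulAt, Op.cupAt, FrobeniusThreeStructure.comul]
    monoidal
  | cup =>
    refine ⟨_, rfl, ?_⟩
    change (λ_ _).hom ≫ Op.cupAt A' A (listObj A A' w) =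
      η_ A' A ▷ listObj A A' w ≫ (α_ _ _ _).hom ≫ A' ◁ 𝟙 _ ≫ 𝟙 _
    simp [Op.cupAt]
  | cupSwap =>
    refine ⟨_, rfl, ?_⟩
    change (λ_ _).hom ≫ Op.cupAt A A' (listObj A A' w) =
      η_ A A' ▷ listObj A A' w ≫ (α_ _ _ _).hom ≫ A ◁ 𝟙 _ ≫ 𝟙 _
    simp [Op.cupAt]
  | cap =>
    refine ⟨_, rfl, ?_⟩
    change ((α_ _ _ _).hom ≫ A ◁ 𝟙 _ ≫ 𝟙 _) ≫ Op.capAt A' A (listObj A A' w) =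
      ε_ A' A ▷ listObj A A' w ≫ (λ_ _).hom
    simp [Op.capAt]
  | capSwap =>
    refine ⟨_, rfl, ?_⟩
    change ((α_ _ _ _).hom ≫ A' ◁ 𝟙 _ ≫ 𝟙 _) ≫ Op.capAt A A' (listObj A A' w) =
      ε_ A A' ▷ listObj A A' w ≫ (λ_ _).hom
    simp [Op.capAt]
  | id X =>
    refine ⟨𝟙 _, rfl, ?_⟩
    rw [FrobeniusThreeStructure.eval, id_whiskerRight, Category.comp_id, Category.id_comp]
  | assocHom X Y Z =>
    refine ⟨𝟙 _, rfl, (Category.comp_id _).trans ?_⟩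
    change (α_ (_ ⊗ _) _ _).hom ≫ _ ◁ (ontoIso A A' Z w).hom ≫
        (α_ _ _ _).hom ≫ _ ◁ (ontoIso A A' Y _).hom ≫ (ontoIso A A' X _).hom =
      (α_ _ _ _).hom ▷ listObj A A' w ≫ (α_ _ _ _).hom ≫
        _ ◁ ((α_ _ _ _).hom ≫ _ ◁ (ontoIso A A' Z w).hom ≫ (ontoIso A A' Y _).hom) ≫
          (ontoIso A A' X _).hom
    simp
  | assocInv X Y Z =>
    refine ⟨𝟙 _, rfl, (Category.comp_id _).trans ?_⟩
    change (α_ _ _ _).hom ≫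
        _ ◁ ((α_ _ _ _).hom ≫ _ ◁ (ontoIso A A' Z w).hom ≫ (ontoIso A A' Y _).hom) ≫
          (ontoIso A A' X _).hom =
      (α_ _ _ _).inv ▷ listObj A A' w ≫ (α_ (_ ⊗ _) _ _).hom ≫ _ ◁ (ontoIso A A' Z w).hom ≫
        (α_ _ _ _).hom ≫ _ ◁ (ontoIso A A' Y _).hom ≫ (ontoIso A A' X _).hom
    simp
  | leftUnitorHom X =>
    refine ⟨𝟙 _, rfl, (Category.comp_id _).trans ?_⟩
    change (α_ _ _ _).hom ≫ _ ◁ (ontoIso A A' X w).hom ≫ (λ_ _).hom =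
      (λ_ _).hom ▷ listObj A A' w ≫ (ontoIso A A' X w).hom
    simp
  | leftUnitorInv X =>
    refine ⟨𝟙 _, rfl, (Category.comp_id _).trans ?_⟩
    change (ontoIso A A' X w).hom =
      (λ_ _).inv ▷ listObj A A' w ≫ (α_ _ _ _).hom ≫ _ ◁ (ontoIso A A' X w).hom ≫ (λ_ _).hom
    simp
  | rightUnitorHom X =>
    refine ⟨𝟙 _, rfl, (Category.comp_id _).trans ?_⟩
    change (α_ _ _ _).hom ≫ _ ◁ (λ_ _).hom ≫ (ontoIso A A' X w).hom =
      (ρ_ _).hom ▷ listObj A A' w ≫ (ontoIso A A' X w).hom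
    simp
  | rightUnitorInv X =>
    refine ⟨𝟙 _, rfl, (Category.comp_id _).trans ?_⟩
    change (ontoIso A A' X w).hom =
      (ρ_ _).inv ▷ listObj A A' w ≫ (α_ _ _ _).hom ≫ _ ◁ (λ_ _).hom ≫ (ontoIso A A' X w).hom
    simp
  | comp D E hD hE =>
    obtain ⟨g, hg, hg'⟩ := hD w
    obtain ⟨k, hk, hk'⟩ := hE w
    refine ⟨g ≫ k, by simp [toOp, hg, hk], ?_⟩
    rw [reassoc_of% hg', hk', FrobeniusThreeStructure.eval, comp_whiskerRight, Category.assoc]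
  | @tensor X Y Z W D E hD hE =>
    obtain ⟨g, hg, hg'⟩ := hE w
    obtain ⟨k, hk, hk'⟩ := hD (Z.onto w)
    obtain ⟨l, hl, hl'⟩ := exists_sh_app hg Y
    refine ⟨k ≫ l, ?_, ?_⟩
    · exact (congrArg (Option.bind · _) hk).trans (congrArg (Option.map _) hl)
    change ((α_ _ _ _).hom ≫ _ ◁ (ontoIso A A' Z w).hom ≫ (ontoIso A A' X _).hom) ≫ k ≫ l =
      (F.eval D ⊗ₘ F.eval E) ▷ listObj A A' w ≫
        (α_ _ _ _).hom ≫ _ ◁ (ontoIso A A' W w).hom ≫ (ontoIso A A' Y _).hom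
    rw [Category.assoc, Category.assoc, reassoc_of% hk', hl', whisker_exchange_assoc,
      ← whiskerLeft_comp_assoc, hg', MonoidalCategory.tensorHom_def]
    simp

end Diagram

/-! ### Bending all inputs to the left -/

namespace Op

variable {C : Type u} [Category.{v} C] [MonoidalCategory C] {A A' : C}

/-- The identity of the words that begin with `w`. -/
def gdWord : List Wire → Op A A'
  | [] => 1
  | x :: w => gd x * sh 1 (gdWord w)

theorem gdWord_app (w v : List Wire) :
    (gdWord w).app (w ++ v) = some ⟨w ++ v, 𝟙 (listObj A A' _)⟩ := by
  induction w with
  | nil => rfl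
  | cons x w ih => simp [gdWord, sh, ih, listObj]

variable [ExactPairing A' A] [ExactPairing A A']

/-- Nested cups, whose right ends form the word `w`. -/
def coev : List Wire → Op A A'
  | [] => 1
  | x :: w => coev w * sh w.length (cup x.dual)

/-- Nested caps, whose left ends form a word of the length of `w`. -/
def ev : List Wire → Op A A'
  | [] => 1
  | _ :: w => sh 1 (ev w) * cap

theorem ev_comm_base (w : List Wire) (Q : Op A A') :
    ev w * sh 0 Q = sh (2 * w.length) Q * ev w := by
  induction w generalizing Q with
  | nil => simp [ev]
  | cons x w ih =>
    rw [ev, mul_assoc, cap_comm_base, ← mul_assoc,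
      sh_comm ih Q (i := 1) (j := 2) (k := 2 * (w.length + 1)) (by omega) (by omega), mul_assoc,
      List.length_cons]

/-- The snake equation for nested cups and caps. -/
theorem coev_ev (w : List Wire) :
    gdWord w * (sh w.length (coev w) * ev w) = gdWord (A := A) (A' := A') w := by
  induction w with
  | nil => simp [gdWord, ev, coev]
  | cons x w ih =>
    have h := sh_comm (ev_comm_base w) (cup (A := A) (A' := A') x.dual) (i := 1) (j := 1)
      (k := 1 + w.length + w.length) (by omega) (by omega)
    calc _ = gd x * (sh 1 (gdWord w * sh w.length (coev w)) *
          (sh (1 + w.length + w.length) (cup x.dual) * sh 1 (ev w)) * cap) := by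
          simp only [gdWord, coev, ev, List.length_cons, map_mul, sh_sh, mul_assoc,
            Nat.add_comm 1 w.length]
      _ = gd x * (sh 1 (gdWord w * (sh w.length (coev w) * ev w)) * (sh 1 (cup x.dual) * cap)) := by
          rw [← h]
          simp only [map_mul, mul_assoc]
      _ = _ := by
          rw [ih, ← mul_assoc, gd_comm_base, mul_assoc, cup_cap', ← gd_comm_base, gdWord]

/-- Bending is invertible. -/
theorem gdWord_mul_eq {w : List Wire} {O P : Op A A'}
    (h : coev w * sh w.length O = coev w * sh w.length P) : gdWord w * O = gdWord w * P := by
  have key (Q : Op A A') :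
      gdWord w * Q = gdWord w * (sh w.length (coev w * sh w.length Q) * ev w) := by
    rw [map_mul, sh_sh, mul_assoc, ← two_mul, ← ev_comm_base, sh_zero, ← mul_assoc, ← mul_assoc,
      mul_assoc (gdWord w), coev_ev]
  rw [key O, h, ← key P]

/-- Nested cups are a planar arrangement, in which a wire has the colour of its mirror image. -/
theorem planar_coev (F : FrobeniusThreeStructure A A') (w : List Wire) :
    ∃ Col, Planar F ((w.map Wire.dual).reverse ++ w) Col w.length (coev w) ∧
      ∀ c, Col c → ∃ k, k.length = w.length ∧ c = k.reverse ++ k := by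
  induction w with
  | nil => exact ⟨_, Planar.nil, fun c hc => ⟨[], rfl, hc⟩⟩
  | cons x w ih =>
    obtain ⟨Col, h, hC⟩ := ih
    refine ⟨_, (Planar.ins x.dual 0 h).congr (by simp [alt]) ?_, fun c hc => ?_⟩
    · simp [coev, blk]
    · obtain ⟨cu, cv, b, hu, rfl, hc⟩ := hc
      obtain ⟨k, hk, hk'⟩ := hC _ hc
      obtain ⟨rfl, rfl⟩ := List.append_inj hk' (by simp [hu, hk])
      exact ⟨b :: cv, by simp [hk], by simp [List.replicate_succ]⟩

end Op

namespace Diagram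

variable {C : Type u} [Category.{v} C] [MonoidalCategory C] {A A' : C}
variable [ExactPairing A' A] [ExactPairing A A'] (F : FrobeniusThreeStructure A A')

/-- A connected diagram, with its inputs bent to the left, is a single canonical block. -/
theorem exists_planar {X Y : Word} (D : Diagram X Y) (hD : D.Connected)
    (h0 : 0 < X.flat.length + Y.flat.length) (h : F.Normal ∨ D.chi = 1) :
    ∃ Col, Planar F ((X.flat.map Wire.dual).reverse ++ (Y.flat ++ [])) Col 1
      (Op.coev X.flat * Op.sh X.flat.length (D.toOp F)) := by
  obtain ⟨Col₀, h₀, hC₀⟩ := Op.planar_coev F X.flat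
  have h₁ : Planar F ((X.flat.map Wire.dual).reverse ++ (X.flat ++ [])) Col₀ _ _ :=
    h₀.congr (by simp) rfl
  have hlen : (X.flat.map Wire.dual).reverse.length = X.flat.length := by simp
  obtain ⟨a₀⟩ := hD.nonempty
  have const {K : D.toGraph.Node → Bool} (hK : D.toGraph.IsColouring K) : K = fun _ => K a₀ :=
    funext fun a => hK.eq hD a a₀
  have hin (b : Bool) : (D.toGraph.inCol fun _ => b) = List.replicate X.flat.length b :=
    X.listOf_const b
  have hout (b : Bool) : (D.toGraph.outCol fun _ => b) = List.replicate Y.flat.length b :=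
    Y.listOf_const b
  -- A wire of `X` and its bent end have the same colour.
  have bent {b : Bool} {cu cv : List Bool} (hu : cu.length = X.flat.length)
      (hc : Col₀ (cu ++ (List.replicate X.flat.length b ++ cv))) :
      cu = List.replicate X.flat.length b ∧ cv = [] := by
    obtain ⟨k, hk, hk'⟩ := hC₀ _ hc
    obtain ⟨rfl, rfl⟩ := List.append_inj hk' (by simp [hu, hk])
    obtain rfl : cv = [] := by simpa using hk
    simp
  rcases D.transforms F h₁ with ⟨K, hK, ⟨a, ha⟩, hfalse, hc⟩ | ⟨Col, n, d, e, he, hn, he', hC⟩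
  · exfalso
    obtain rfl : K = fun _ => true := (const hK).trans (by rw [← hK.eq hD a a₀, ha])
    rw [hin, hlen] at hc
    have h₂ := (bent (by simp) hc).1
    have hX : X.flat.length = 0 := by
      rcases List.replicate_inj.1 h₂ with ⟨-, h | h⟩
      · exact h
      · exact absurd h (by decide)
    rw [hX, zero_add, ← Y.card_port, Fintype.card_pos_iff] at h0
    obtain ⟨p⟩ := h0
    exact Bool.noConfusion (hfalse p)
  · have h₂ : n < 2 := by
      by_contra! h₂
      obtain ⟨c, hc, ht, hf⟩ := he.exists_col h₂
      obtain ⟨cu, K, cv, hu, rfl, hc', hK⟩ := hC c hc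
      rw [const hK, hin] at hc'
      rw [const hK, hout] at ht hf
      obtain ⟨rfl, rfl⟩ := bent (hu.trans hlen) hc'
      simp only [List.append_nil, List.mem_append, List.mem_replicate, ← or_and_right] at ht hf
      exact absurd (ht.2.trans hf.2.symm) (by decide)
    have h₃ : n ≠ 0 := by
      rintro rfl
      have := congrArg List.length he.eq_nil.1
      rw [List.length_append, hlen, List.append_nil, List.length_nil] at this
      omega
    obtain rfl : n = 1 := by omega
    have hd : F.Normal ∨ d = 0 := h.imp_right fun h => by rw [h] at hn; omega
    exact ⟨Col, he.congr rfl (by rw [← he' hd, hlen])⟩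

/-- Both diagrams, bent to the left, are single blocks on the same word, hence are equal. -/
theorem eval_eq {X Y : Word} {D E : Diagram X Y} (hD : D.Connected) (hE : E.Connected)
    (h0 : 0 < X.flat.length + Y.flat.length) (h : F.Normal ∨ D.chi = 1 ∧ E.chi = 1) :
    F.eval D = F.eval E := by
  obtain ⟨_, h₁⟩ := D.exists_planar F hD h0 (h.imp_right And.left)
  obtain ⟨_, h₂⟩ := E.exists_planar F hE h0 (h.imp_right And.right)
  have hOp := Op.gdWord_mul_eq (h₁.unique h₂)
  obtain ⟨f, hf, hf'⟩ := D.exists_toOp_app F []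
  obtain ⟨g, hg, hg'⟩ := E.exists_toOp_app F []
  have key (O : Op A A') : (Op.gdWord X.flat * O).app (X.onto []) = O.app (X.onto []) := by
    have h := Op.gdWord_app (A := A) (A' := A') X.flat []
    rw [← X.onto_eq] at h
    cases h' : O.app (X.onto []) <;> simp [h, h']
  have hfg := key (D.toOp F)
  rw [hOp, key, hf, hg] at hfg
  obtain rfl : g = f := by simpa using hfg
  rw [hf', cancel_mono] at hg'
  exact (whiskerRight_iff _ _).1 hg'

end Diagram

end FrobeniusThree

theorem mainTheorem5 {C : Type u} [Category.{v} C] [MonoidalCategory C] {A A' : C}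
    [ExactPairing A' A] [ExactPairing A A'] (F : FrobeniusThreeStructure A A') :
    (F.Sliding →
      ∀ (X Y : FrobeniusThree.Word) (D E : FrobeniusThree.Diagram X Y),
        D.Connected → E.Connected → D.NoInternalLoops → E.NoInternalLoops →
          F.eval D = F.eval E) ∧
    (F.Normal →
      ∀ (X Y : FrobeniusThree.Word) (D E : FrobeniusThree.Diagram X Y),
        D.Connected → E.Connected → 1 < X.numWires + Y.numWires →
          F.eval D = F.eval E) := by
  refine ⟨fun _ X Y D E hD hE hD' hE' => ?_, fun hF X Y D E hD hE h => ?_⟩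
  · have hχ := D.hasEuler.eq_one ⟨hD, hD'⟩
    have := D.two_mul_chi_le
    exact FrobeniusThree.Diagram.eval_eq F hD hE (by omega)
      (Or.inr ⟨hχ, E.hasEuler.eq_one ⟨hE, hE'⟩⟩)
  · rw [← X.length_flat, ← Y.length_flat] at h
    exact FrobeniusThree.Diagram.eval_eq F hD hE (by omega) (Or.inl hF)
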